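/- Let $G$ be a compact (Hausdorff) group with neutral element $e$ and normalized Haar measure $dx$. For each class $\xi$ in the unitary dual $\widehat G$ fix a unitary matrix representative $\xi:G\to\mathbb C^{d_\xi\times d_\xi}$, and put $\widehat u(\xi)=\int u(x)\,\xi(x)^*\,dx$. Let $\mathscr S(G)$ be the space of Schwartz--Bruhat test functions (smooth functions on $G$ that factor through a compact Lie quotient of $G$), and let $\mathscr S'(G)$ be its dual, the space of Schwartz--Bruhat distributions. Let $\mathscr S(G\times\widehat G)=(I\otimes\mathscr F)\mathscr S(G\times G)$ be the matrix-valued functions $a(x,\eta)=\int\eta(y)^*w(x,y)\,dy$ with $w\in\mathscr S(G\times G)$, with $\langle a,b\rangle=\int_G\sum_{\eta\in\widehat G}d_\eta\,\mathrm{tr}\big(a(x,\eta)b(x,\eta)^*\big)\,dx$; similarly $\mathscr S(\widehat G\times G)=(\mathscr F\otimes I)\mathscr S(G\times G)$, and let $F=(\mathscr F\otimes I)(I\otimes\mathscr F^{-1}):\mathscr S(G\times\widehat G)\to\mathscr S(\widehat G\times G)$ be the symplectic Fourier transform. The Kohn--Nirenberg transform is $R(u,v)(x,\eta)=u(x)\,\eta(x)^*\,\widehat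 v(\eta)^*$. A time-frequency transform is a mapping $D:\mathscr S(G)\times\mathscr S(G)\to\mathscr S(G\times\widehat G)$ of the form $D(u,v)=F^{-1}\big(\phi_D\,FR(u,v)\big)$ with an ambiguity kernel $\phi_D(\xi,y)\in\mathbb C^{d_\xi\times d_\xi}$, $(\xi,y)\in\widehat G\times G$. By the same formula, understood by duality, it is extended to distributions $f,g\in\mathscr S'(G)$, with $D(f,g)\in\mathscr S'(G\times\widehat G)$. For a symbol $a\in\mathscr S(G\times\widehat G)$, the operator $a^D$ on $L^2(G)$ is defined by $\langle u,a^Dv\rangle=\langle D(u,v),a\rangle$ for all $u,v\in\mathscr S(G)$. Here $\langle u,v\rangle=\int u(x)\,v(x)^*\,dx$, and the same notation is used for the pairing of test functions with distributions; $\mathbf 1$ is the constant function $1$ and $\delta_y$ the Dirac delta at $y$. **Theorem.** For every time-frequency transform $D$ on $G$ the following conditions are equivalent: (a) $\langle D(u,\mathbf 1),D(\delta_e,\delta_y)\rangle=u(e)$ for all $u\in\mathscr S(G)$ and $y\in G$; (b) $D$ is unitary, i.e. it satisfies the Moyal identity $\langle D(u,v),D(f,g)\rangle=\langle u,f\rangle\,\langle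 v,g\rangle^*$ for all $u,v\in\mathscr S(G)$ and $f,g\in\mathscr S'(G)$; (c) the $D$-quantization is unitary, i.e. $\langle a,b\rangle=\mathrm{tr}\big(a^D(b^D)^*\big)$ for all $a,b\in\mathscr S(G\times\widehat G)$; (d) the matrix $\phi_D(\xi,y)$ is unitary for every $(\xi,y)\in\widehat G\times G$. In particular the Kohn--Nirenberg transform $R$, which is the time-frequency transform with kernel $\phi_R(\xi,y)=I$, is unitary. -/

import Mathlib

open MeasureTheory Matrix
open scoped ContDiff ComplexConjugate

noncomputable section

namespace TimeFrequency

universe u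

/-! ### Schwartz--Bruhat test functions and distributions on a compact group -/

section SchwartzBruhat

variable {G : Type u} [Group G] [TopologicalSpace G]

/-- The matrix entries of `A`, as a point of the normed space `ι → ι → ℂ`. -/
def entries {ι : Type} [Fintype ι] [DecidableEq ι] (A : Matrix.unitaryGroup ι ℂ) : ι → ι → ℂ :=
  fun i j => (A : Matrix ι ι ℂ) i j

/-- `u` is a Schwartz--Bruhat test function on the compact group `G`: it factors through a compact
Lie quotient of `G` as a smooth function. The compact Lie quotients `G ⧸ K` are exactly the images
`ρ(G) ≅ G ⧸ ker ρ` of continuous homomorphisms `ρ` of `G` to unitary groups `U(ι)`, which are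
compact submanifolds of the matrix space, and the smooth functions on such a submanifold are the
restrictions of the (real-)smooth functions of the matrix entries. -/
def IsSchwartz (u : G → ℂ) : Prop :=
  ∃ (ι : Type) (_ : Fintype ι) (_ : DecidableEq ι) (ρ : G →ₜ* Matrix.unitaryGroup ι ℂ)
    (F : (ι → ι → ℂ) → ℂ), ContDiff ℝ ∞ F ∧ ∀ x, u x = F (entries (ρ x))

theorem continuous_entries {ι : Type} [Fintype ι] [DecidableEq ι] :
    Continuous (entries : Matrix.unitaryGroup ι ℂ → ι → ι → ℂ) := by
  refine continuous_pi fun i => continuous_pi fun j => ?_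
  exact (continuous_subtype_val : Continuous fun A : Matrix.unitaryGroup ι ℂ =>
    (A : Matrix ι ι ℂ)).matrix_elem i j

theorem IsSchwartz.continuous {u : G → ℂ} (hu : IsSchwartz u) : Continuous u := by
  obtain ⟨ι, _, _, ρ, F, hF, h⟩ := hu
  have : u = fun x => F (entries (ρ x)) := funext h
  rw [this]
  exact hF.continuous.comp (continuous_entries.comp ρ.continuous_toFun)

theorem IsSchwartz.comp_left {u : G → ℂ} (hu : IsSchwartz u) {φ : ℂ → ℂ} (hφ : ContDiff ℝ ∞ φ) :
    IsSchwartz fun x => φ (u x) := by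
  obtain ⟨ι, i1, i2, ρ, F, hF, h⟩ := hu
  exact ⟨ι, i1, i2, ρ, fun A => φ (F A), hφ.comp hF, fun x => by simp only [h]⟩

/-- The direct sum of two finite-dimensional unitary representations. -/
def directSum {ι κ : Type} [Fintype ι] [DecidableEq ι] [Fintype κ] [DecidableEq κ]
    (ρ : G →ₜ* Matrix.unitaryGroup ι ℂ) (σ : G →ₜ* Matrix.unitaryGroup κ ℂ) :
    G →ₜ* Matrix.unitaryGroup (ι ⊕ κ) ℂ where
  toFun x := ⟨Matrix.fromBlocks (ρ x : Matrix ι ι ℂ) 0 0 (σ x : Matrix κ κ ℂ), by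
    rw [Matrix.mem_unitaryGroup_iff, Matrix.star_eq_conjTranspose,
      Matrix.fromBlocks_conjTranspose, Matrix.fromBlocks_multiply]
    have h1 := Matrix.mem_unitaryGroup_iff.1 (ρ x).2
    have h2 := Matrix.mem_unitaryGroup_iff.1 (σ x).2
    rw [Matrix.star_eq_conjTranspose] at h1 h2
    simp [h1, h2]⟩
  map_one' := by
    apply Subtype.ext
    simp
  map_mul' x y := by
    apply Subtype.ext
    simp [Matrix.fromBlocks_multiply]
  continuous_toFun := by
    refine Continuous.subtype_mk ?_ _
    exact Continuous.matrix_fromBlocks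
      (continuous_subtype_val.comp ρ.continuous_toFun) continuous_const continuous_const
      (continuous_subtype_val.comp σ.continuous_toFun)

theorem IsSchwartz.map₂ {u v : G → ℂ} (hu : IsSchwartz u) (hv : IsSchwartz v)
    {φ : ℂ × ℂ → ℂ} (hφ : ContDiff ℝ ∞ φ) : IsSchwartz fun x => φ (u x, v x) := by
  obtain ⟨ι, i1, i2, ρ, F, hF, h⟩ := hu
  obtain ⟨κ, j1, j2, σ, H, hH, h'⟩ := hv
  refine ⟨ι ⊕ κ, inferInstance, inferInstance, directSum ρ σ,
    fun A => φ (F (fun i j => A (Sum.inl i) (Sum.inl j)),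
      H (fun i j => A (Sum.inr i) (Sum.inr j))), ?_, ?_⟩
  · refine hφ.comp (ContDiff.prodMk (hF.comp ?_) (hH.comp ?_))
    · fun_prop
    · fun_prop
  · intro x
    simp only [h, h']
    rfl

variable (G) in
/-- The space `𝒮(G)` of Schwartz--Bruhat test functions on the compact group `G`. -/
def SchwartzBruhat : Submodule ℂ (G → ℂ) where
  carrier := {u | IsSchwartz u}
  add_mem' {u v} hu hv := by
    have : ContDiff ℝ ∞ fun p : ℂ × ℂ => p.1 + p.2 := by fun_prop
    exact IsSchwartz.map₂ hu hv this
  zero_mem' := ⟨Empty, inferInstance, inferInstance,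
    { toFun := fun _ => 1, map_one' := rfl, map_mul' := by simp,
      continuous_toFun := continuous_const }, fun _ => 0, contDiff_const, fun _ => rfl⟩
  smul_mem' c u hu := by
    have : ContDiff ℝ ∞ fun z : ℂ => c * z := by fun_prop
    exact IsSchwartz.comp_left hu this

/-- The unit constant function `𝟏 ∈ 𝒮(G)`. -/
def SchwartzBruhat.one : SchwartzBruhat G :=
  ⟨fun _ => 1, Empty, inferInstance, inferInstance,
    { toFun := fun _ => 1, map_one' := rfl, map_mul' := by simp,
      continuous_toFun := continuous_const }, fun _ => 1, contDiff_const, fun _ => rfl⟩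

variable (G) in
/-- The space `𝒮'(G)` of Schwartz--Bruhat distributions, i.e. of the linear functionals on `𝒮(G)`,
thought of as `u ↦ ∫ T(x) u(x) dx`, that are continuous for the inductive limit topology:
the restriction to the smooth functions on each compact Lie quotient `ρ(G)` is bounded by finitely
many derivatives. -/
structure SchwartzDistribution where
  toLinearMap : SchwartzBruhat G →ₗ[ℂ] ℂ
  continuous' : ∀ (ι : Type) [Fintype ι] [DecidableEq ι] (ρ : G →ₜ* Matrix.unitaryGroup ι ℂ),
    ∃ (C : ℝ) (N : ℕ), ∀ (F : (ι → ι → ℂ) → ℂ) (M : ℝ) (u : SchwartzBruhat G),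
      ContDiff ℝ ∞ F → (∀ x, (u : G → ℂ) x = F (entries (ρ x))) →
      (∀ k ≤ N, ∀ x, ‖iteratedFDeriv ℝ k F (entries (ρ x))‖ ≤ M) →
      ‖toLinearMap u‖ ≤ C * M

/-- The Dirac delta distribution `δ_y`. -/
def dirac (y : G) : SchwartzDistribution G where
  toLinearMap := (LinearMap.proj y).comp (SchwartzBruhat G).subtype
  continuous' ι _ _ ρ := by
    refine ⟨1, 0, fun F M u _ hu hM => ?_⟩
    have := hM 0 le_rfl y
    rw [norm_iteratedFDeriv_zero] at this
    simpa [hu y] using this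

open Classical in
/-- The value `T(h)` of the distribution `T` at the test function `h`
(and `0` if `h` is not a test function). -/
def SchwartzDistribution.eval (T : SchwartzDistribution G) (h : G → ℂ) : ℂ :=
  if hh : h ∈ SchwartzBruhat G then T.toLinearMap ⟨h, hh⟩ else 0

/-- The pairing `⟨h, T⟩ = ∫ h(x) T(x)^* dx` of the test function `h` and the distribution `T`. -/
def SchwartzDistribution.pairing (h : G → ℂ) (T : SchwartzDistribution G) : ℂ :=
  conj (T.eval fun x => conj (h x))

end SchwartzBruhat

/-! ### The unitary dual -/

section Dual

variable (G : Type u) [Group G] [TopologicalSpace G]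

/-- An irreducible unitary matrix representation of `G`. -/
structure UnitaryIrrep where
  dim : ℕ
  rep : G →ₜ* Matrix.unitaryGroup (Fin dim) ℂ
  dim_pos : 0 < dim
  irreducible : ∀ V : Submodule ℂ (Fin dim → ℂ),
    (∀ x, ∀ v ∈ V, (rep x : Matrix (Fin dim) (Fin dim) ℂ) *ᵥ v ∈ V) → V = ⊥ ∨ V = ⊤

variable {G} in
theorem UnitaryIrrep.continuous_mat (ξ : UnitaryIrrep G) :
    Continuous fun x => (ξ.rep x : Matrix (Fin ξ.dim) (Fin ξ.dim) ℂ) :=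
  continuous_subtype_val.comp ξ.rep.continuous_toFun

/-- Unitary equivalence of irreducible unitary representations. -/
instance UnitaryIrrep.setoid : Setoid (UnitaryIrrep G) where
  r ξ η := ∃ U : Matrix (Fin η.dim) (Fin ξ.dim) ℂ, Uᴴ * U = 1 ∧ U * Uᴴ = 1 ∧
    ∀ x, U * (ξ.rep x : Matrix (Fin ξ.dim) (Fin ξ.dim) ℂ) =
      (η.rep x : Matrix (Fin η.dim) (Fin η.dim) ℂ) * U
  iseqv :=
    { refl := fun ξ => ⟨1, by simp, by simp, by simp⟩
      symm := by
        rintro ξ η ⟨U, h1, h2, h⟩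
        refine ⟨Uᴴ, by simpa using h2, by simpa using h1, fun x => ?_⟩
        calc Uᴴ * (η.rep x : Matrix (Fin η.dim) (Fin η.dim) ℂ)
            = Uᴴ * (η.rep x : Matrix (Fin η.dim) (Fin η.dim) ℂ) * (U * Uᴴ) := by
              rw [h2, Matrix.mul_one]
          _ = Uᴴ * ((η.rep x : Matrix (Fin η.dim) (Fin η.dim) ℂ) * U) * Uᴴ := by
              simp only [Matrix.mul_assoc]
          _ = (Uᴴ * U) * (ξ.rep x : Matrix (Fin ξ.dim) (Fin ξ.dim) ℂ) * Uᴴ := by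
              rw [← h x]; simp only [Matrix.mul_assoc]
          _ = _ := by rw [h1, Matrix.one_mul]
      trans := by
        rintro ξ η ζ ⟨U, h1, h2, h⟩ ⟨V, k1, k2, k⟩
        refine ⟨V * U, ?_, ?_, fun x => ?_⟩
        · rw [Matrix.conjTranspose_mul, Matrix.mul_assoc, ← Matrix.mul_assoc Vᴴ, k1,
            Matrix.one_mul, h1]
        · rw [Matrix.conjTranspose_mul, Matrix.mul_assoc, ← Matrix.mul_assoc U, h2,
            Matrix.one_mul, k2]
        · rw [Matrix.mul_assoc, h x, ← Matrix.mul_assoc, k x, Matrix.mul_assoc] }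

/-- The unitary dual `Ĝ` of the compact group `G` (all irreducible unitary representations of a
compact group are finite-dimensional, hence equivalent to matrix representations). -/
def UnitaryDual : Type u := Quotient (UnitaryIrrep.setoid G)

variable {G}

/-- The dimension `d_ξ`. -/
def UnitaryDual.dim (ξ : UnitaryDual G) : ℕ := (Quotient.out ξ : UnitaryIrrep G).dim

/-- The matrix `ξ(x) ∈ ℂ^{d_ξ × d_ξ}` of a chosen representative of `ξ ∈ Ĝ`. -/
def UnitaryDual.mat (ξ : UnitaryDual G) (x : G) : Matrix (Fin ξ.dim) (Fin ξ.dim) ℂ :=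
  ((Quotient.out ξ : UnitaryIrrep G).rep x).1

variable (G) in
/-- Matrix-valued functions `a(x, η) ∈ ℂ^{d_η × d_η}` on the time-frequency plane `G × Ĝ`. -/
abbrev TFField : Type u := G → (η : UnitaryDual G) → Matrix (Fin η.dim) (Fin η.dim) ℂ

variable (G) in
/-- Matrix-valued functions `φ(ξ, y) ∈ ℂ^{d_ξ × d_ξ}` on the ambiguity plane `Ĝ × G`. -/
abbrev AmbiguityField : Type u := (ξ : UnitaryDual G) → G → Matrix (Fin ξ.dim) (Fin ξ.dim) ℂ

end Dual

/-! ### Fourier transforms -/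

section Fourier

variable (G : Type u) [Group G] [TopologicalSpace G] [IsTopologicalGroup G] [CompactSpace G]
  [MeasurableSpace G] [BorelSpace G]

/-- The Haar probability measure of the compact group `G`. -/
def haarProb : Measure G := Measure.haarMeasure (⊤ : TopologicalSpace.PositiveCompacts G)

variable {G}

/-- The Fourier coefficient `û(ξ) = ∫ u(x) ξ(x)^* dx`. -/
def fourierCoeff (u : G → ℂ) (ξ : UnitaryDual G) : Matrix (Fin ξ.dim) (Fin ξ.dim) ℂ :=
  Matrix.of fun i j => ∫ x, u x * (ξ.mat x)ᴴ i j ∂(haarProb G)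

/-- The partial Fourier transform `(I ⊗ 𝓕) w (x, η) = ∫ η(y)^* w(x, y) dy`. -/
def fourierLag (w : G × G → ℂ) : TFField G := fun x η => fourierCoeff (fun y => w (x, y)) η

/-- The partial Fourier transform `(𝓕 ⊗ I) w (ξ, y) = ∫ ξ(x)^* w(x, y) dx`. -/
def fourierTime (w : G × G → ℂ) : AmbiguityField G :=
  fun ξ y => fourierCoeff (fun x => w (x, y)) ξ

variable (G) in
/-- The test function space `𝒮(G × Ĝ) = (I ⊗ 𝓕) 𝒮(G × G)`. -/
def TFSchwartz : Set (TFField G) := fourierLag '' (SchwartzBruhat (G × G) : Set (G × G → ℂ))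

variable (G) in
/-- The test function space `𝒮(Ĝ × G) = (𝓕 ⊗ I) 𝒮(G × G)`. -/
def AmbiguitySchwartz : Set (AmbiguityField G) :=
  fourierTime '' (SchwartzBruhat (G × G) : Set (G × G → ℂ))

/-- The inverse of the linear isomorphism `I ⊗ 𝓕 : 𝒮(G × G) → 𝒮(G × Ĝ)`. -/
def fourierLagInv (a : TFField G) : G × G → ℂ :=
  Function.invFunOn fourierLag (SchwartzBruhat (G × G) : Set (G × G → ℂ)) a

/-- The inverse of the linear isomorphism `𝓕 ⊗ I : 𝒮(G × G) → 𝒮(Ĝ × G)`. -/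
def fourierTimeInv (c : AmbiguityField G) : G × G → ℂ :=
  Function.invFunOn fourierTime (SchwartzBruhat (G × G) : Set (G × G → ℂ)) c

/-- The symplectic Fourier transform `F = (𝓕 ⊗ I)(I ⊗ 𝓕⁻¹) : 𝒮(G × Ĝ) → 𝒮(Ĝ × G)`. -/
def sympFourier (a : TFField G) : AmbiguityField G := fourierTime (fourierLagInv a)

/-- The inverse symplectic Fourier transform `F⁻¹ : 𝒮(Ĝ × G) → 𝒮(G × Ĝ)`. -/
def sympFourierInv (c : AmbiguityField G) : TFField G := fourierLag (fourierTimeInv c)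

/-- The inner product `⟨a, b⟩ = ∫_G ∑_η d_η tr(a(x,η) b(x,η)^*) dx` on the time-frequency plane. -/
def tfInner (a b : TFField G) : ℂ :=
  ∫ x, ∑' η : UnitaryDual G, (η.dim : ℂ) * (a x η * (b x η)ᴴ).trace ∂(haarProb G)

/-- The Kohn--Nirenberg (Rihaczek) transform `R(u,v)(x,η) = u(x) η(x)^* v̂(η)^*`. -/
def rihaczek (u v : G → ℂ) : TFField G :=
  fun x η => u x • ((η.mat x)ᴴ * (fourierCoeff v η)ᴴ)

/-- `R(f,g)(x,η) = f(x) η(x)^* ĝ(η)^*` for distributions `f, g ∈ 𝒮'(G)`, as the element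
`a ↦ ⟨a, R(f,g)⟩` of `𝒮'(G × Ĝ)`. Since `R(f,g)` is the partial Fourier transform `I ⊗ 𝓕` of
`f(x) g(x y⁻¹)^*`, its pairing with `a = (I ⊗ 𝓕) w` is
`∬ w(x,y) f(x)^* g(x y⁻¹) dy dx = ∫ f(x)^* ∫ w(x, z⁻¹ x) g(z) dz dx`. Here the distributions are
evaluated at test functions only: for `w ∈ 𝒮(G × G)` the functions `z ↦ w(x, z⁻¹ x)` and
`x ↦ g(z ↦ w(x, z⁻¹ x))` belong to `𝒮(G)`. -/
def rihaczekDistribution (f g : SchwartzDistribution G) (a : TFField G) : ℂ :=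
  SchwartzDistribution.pairing (fun x => g.eval fun z => fourierLagInv a (x, z⁻¹ * x)) f

end Fourier

/-! ### Time-frequency transforms -/

section Transform

variable (G : Type u) [Group G] [TopologicalSpace G] [IsTopologicalGroup G] [CompactSpace G]
  [MeasurableSpace G] [BorelSpace G]

/-- A time-frequency transform `D(u,v) = F⁻¹(φ_D · F R(u,v))`, given by its ambiguity kernel
`φ_D`, where `D` maps `𝒮(G) × 𝒮(G)` to `𝒮(G × Ĝ)`. (This mapping property, applied to `v = 𝟏` and to
the entries `u` of `ξ`, forces the entries of the distributions `φ_D(ξ, ·)` to be test functions, so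
that the kernel is a function; it also forces its polynomial growth in `ξ`.) -/
structure TFTransform where
  kernel : AmbiguityField G
  mapsTo' : ∀ u v : SchwartzBruhat G,
    (fun ξ y => kernel ξ y * sympFourier (rihaczek (u : G → ℂ) (v : G → ℂ)) ξ y)
      ∈ AmbiguitySchwartz G

variable {G}

namespace TFTransform

variable (D : TFTransform G)

/-- `D(u,v) = F⁻¹(φ_D · F R(u,v)) ∈ 𝒮(G × Ĝ)` for test functions `u, v`. -/
def transform (u v : SchwartzBruhat G) : TFField G :=
  sympFourierInv fun ξ y => D.kernel ξ y * sympFourier (rihaczek (u : G → ℂ) (v : G → ℂ)) ξ y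

/-- `D(f,g) = F⁻¹(φ_D · F R(f,g)) ∈ 𝒮'(G × Ĝ)` for distributions `f, g`, as `a ↦ ⟨a, D(f,g)⟩`;
by duality `⟨a, F⁻¹(φ_D · F R(f,g))⟩ = ⟨F⁻¹(φ_D^* · F a), R(f,g)⟩`. -/
def distribution (f g : SchwartzDistribution G) (a : TFField G) : ℂ :=
  rihaczekDistribution f g (sympFourierInv fun ξ y => (D.kernel ξ y)ᴴ * sympFourier a ξ y)

/-- The Moyal identity `⟨D(u,v), D(f,g)⟩ = ⟨u,f⟩ ⟨v,g⟩^*` for `u, v ∈ 𝒮(G)`, `f, g ∈ 𝒮'(G)`. -/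
def IsUnitary : Prop :=
  ∀ (u v : SchwartzBruhat G) (f g : SchwartzDistribution G),
    D.distribution f g (D.transform u v) =
      SchwartzDistribution.pairing (u : G → ℂ) f * conj (SchwartzDistribution.pairing (v : G → ℂ) g)

end TFTransform

instance : IsProbabilityMeasure (haarProb G) :=
  ⟨by
    have := Measure.haarMeasure_self (K₀ := (⊤ : TopologicalSpace.PositiveCompacts G))
    simpa [haarProb] using this⟩

instance : (haarProb G).IsHaarMeasure := by unfold haarProb; infer_instance

instance : (haarProb G).Regular := by unfold haarProb; infer_instance

instance : (haarProb G).IsMulRightInvariant := ⟨fun g => by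
  have : IsProbabilityMeasure (Measure.map (· * g) (haarProb G)) :=
    Measure.isProbabilityMeasure_map (measurable_mul_const g).aemeasurable
  exact Measure.isHaarMeasure_eq_of_isProbabilityMeasure _ _⟩

instance : (haarProb G).IsInvInvariant := ⟨by
  have hp : IsProbabilityMeasure (haarProb G).inv :=
    Measure.isProbabilityMeasure_map measurable_inv.aemeasurable
  have h := Measure.isMulInvariant_eq_smul_of_compactSpace (haarProb G).inv (haarProb G)
  have h1 : (haarProb G).inv Set.univ = 1 := hp.measure_univ
  rw [h, Measure.smul_apply, measure_univ] at h1
  have h2 : Measure.haarScalarFactor (haarProb G).inv (haarProb G) = 1 := by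
    simpa [ENNReal.smul_def] using h1
  rw [h, h2, one_smul]⟩

/-- A test function as an element of `L²(G)`. -/
def schwartzToL2 (u : SchwartzBruhat G) : Lp ℂ 2 (haarProb G) :=
  ContinuousMap.toLp 2 (haarProb G) ℂ ⟨(u : G → ℂ), IsSchwartz.continuous u.2⟩

/-- The bounded operator `A` on `L²(G)` is the `D`-quantization `a^D` of the symbol `a`:
`⟨u, a^D v⟩ = ⟨D(u,v), a⟩` for all test functions `u, v`. (Mathlib's `inner ℂ f g` is linear
in `g`, so that `⟨u, A v⟩` is `inner ℂ (A v) u`.) -/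
def TFTransform.IsQuantization (D : TFTransform G) (a : TFField G)
    (A : Lp ℂ 2 (haarProb G) →L[ℂ] Lp ℂ 2 (haarProb G)) : Prop :=
  ∀ u v : SchwartzBruhat G, inner ℂ (A (schwartzToL2 v)) (schwartzToL2 u) = tfInner (D.transform u v) a

/-- The bounded operator `T` has trace `c`: `∑ ⟨T e_i, e_i⟩` converges (unconditionally, that is
absolutely) to `c` for every orthonormal basis. -/
def HasTrace {H : Type u} [NormedAddCommGroup H] [InnerProductSpace ℂ H]
    (T : H →L[ℂ] H) (c : ℂ) : Prop :=
  ∀ (ι : Type u) (e : HilbertBasis ι ℂ H), HasSum (fun i => inner ℂ (e i) (T (e i))) c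

/-- The `D`-quantization is unitary: for all `a, b ∈ 𝒮(G × Ĝ)`, with the corresponding operators
`A = a^D` and `B = b^D` on `L²(G)`, we have `⟨a, b⟩ = ⟨a^D, b^D⟩ = tr(a^D (b^D)^*)`. -/
def TFTransform.QuantizationIsUnitary (D : TFTransform G) : Prop :=
  ∀ a ∈ TFSchwartz G, ∀ b ∈ TFSchwartz G,
    ∃ A B : Lp ℂ 2 (haarProb G) →L[ℂ] Lp ℂ 2 (haarProb G),
      D.IsQuantization a A ∧ D.IsQuantization b B ∧
        HasTrace (A ∘L ContinuousLinearMap.adjoint B) (tfInner a b)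

end Transform

/-! ### The Kohn--Nirenberg transform as a time-frequency transform -/

section KohnNirenberg

set_option linter.unusedSectionVars false

variable {G : Type u} [Group G] [TopologicalSpace G] [IsTopologicalGroup G] [CompactSpace G]
  [MeasurableSpace G] [BorelSpace G]

/-- `(x, y) ↦ u(x) v(x y⁻¹)^*`, the inverse partial Fourier transform of `R(u,v)`. -/
def lagProduct (u v : G → ℂ) : G × G → ℂ := fun p => u p.1 * conj (v (p.1 * p.2⁻¹))

theorem lagProduct_mem (u v : SchwartzBruhat G) :
    lagProduct (u : G → ℂ) (v : G → ℂ) ∈ SchwartzBruhat (G × G) := by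
  have hfst : IsSchwartz fun p : G × G => (u : G → ℂ) p.1 := by
    obtain ⟨ι, i1, i2, ρ, F, hF, h⟩ := u.2
    exact ⟨ι, i1, i2, ρ.comp (ContinuousMonoidHom.fst G G), F, hF, fun p => h p.1⟩
  have hlag : IsSchwartz fun p : G × G => (v : G → ℂ) (p.1 * p.2⁻¹) := by
    obtain ⟨κ, j1, j2, σ, F, hF, h⟩ := v.2
    refine ⟨κ ⊕ κ, inferInstance, inferInstance,
      directSum (σ.comp (ContinuousMonoidHom.fst G G)) (σ.comp (ContinuousMonoidHom.snd G G)),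
      fun A => F fun i j => ∑ k, A (Sum.inl i) (Sum.inl k) * conj (A (Sum.inr j) (Sum.inr k)),
      hF.comp ?_, fun p => ?_⟩
    · refine contDiff_pi.2 fun i => contDiff_pi.2 fun j => ContDiff.sum fun k _ => ?_
      refine ContDiff.mul (by fun_prop) (Complex.conjCLE.contDiff.comp ?_)
      fun_prop
    · change (v : G → ℂ) (p.1 * p.2⁻¹) = _
      rw [h]
      congr 1
      ext i j
      simp only [entries, map_mul, map_inv, Submonoid.coe_mul, Matrix.mul_apply]
      rfl
  have hφ : ContDiff ℝ ∞ fun p : ℂ × ℂ => p.1 * conj p.2 :=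
    contDiff_fst.mul (Complex.conjCLE.contDiff.comp contDiff_snd)
  exact IsSchwartz.map₂ hfst hlag hφ

theorem fourierLag_lagProduct (u v : SchwartzBruhat G) :
    fourierLag (lagProduct (u : G → ℂ) (v : G → ℂ)) = rihaczek (u : G → ℂ) (v : G → ℂ) := by
  ext x η i j
  have hmat : Continuous fun y : G => η.mat y := UnitaryIrrep.continuous_mat _
  have hinv : ∀ z, η.mat (z⁻¹ * x) = (η.mat z)ᴴ * η.mat x := fun z => by
    simp only [UnitaryDual.mat, map_mul, map_inv, Submonoid.coe_mul]
    rfl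
  have key := integral_div_left_eq_self
    (fun z => (u : G → ℂ) x * conj ((v : G → ℂ) z) * conj (η.mat (z⁻¹ * x) j i)) (haarProb G) x
  have h1 : ∀ y : G, (x / y)⁻¹ * x = y := fun y => by simp
  simp only [h1] at key
  have h2 : fourierLag (lagProduct (u : G → ℂ) (v : G → ℂ)) x η i j =
      ∫ y, (u : G → ℂ) x * conj ((v : G → ℂ) (x / y)) * conj (η.mat y j i) ∂(haarProb G) := by
    simp only [fourierLag, fourierCoeff, lagProduct, Matrix.of_apply, Matrix.conjTranspose_apply,
      div_eq_mul_inv]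
    rfl
  have hv : Continuous (v : G → ℂ) := IsSchwartz.continuous v.2
  rw [h2, key]
  simp only [rihaczek, fourierCoeff, hinv, Matrix.smul_apply, Matrix.mul_apply,
    Matrix.conjTranspose_apply, Matrix.of_apply, smul_eq_mul]
  have h3 : ∀ k, star (∫ z, (v : G → ℂ) z * star (η.mat z k j) ∂(haarProb G)) =
      ∫ z, conj ((v : G → ℂ) z) * η.mat z k j ∂(haarProb G) := fun k => by
    rw [← starRingEnd_apply, ← integral_conj]
    simp
  simp only [h3]
  rw [Finset.mul_sum]
  simp only [← integral_const_mul]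
  rw [← integral_finsetSum]
  · refine integral_congr_ae (Filter.Eventually.of_forall fun z => ?_)
    simp only [map_sum, map_mul, Finset.mul_sum]
    refine Finset.sum_congr rfl fun k _ => ?_
    simp only [starRingEnd_apply, star_star]
    ring
  · intro k _
    have hc : Continuous fun z : G => (u : G → ℂ) x *
        (star (η.mat x k i) * (conj ((v : G → ℂ) z) * η.mat z k j)) := by
      have := hmat.matrix_elem k j
      have := Complex.continuous_conj.comp hv
      fun_prop
    exact hc.integrable_of_hasCompactSupport (HasCompactSupport.of_compactSpace _)

variable (G) in
/-- The Kohn--Nirenberg transform `R`: the time-frequency transform with kernel `φ_R(ξ,y) = I`. -/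
def kohnNirenberg : TFTransform G where
  kernel _ _ := 1
  mapsTo' u v := by
    simp only [Matrix.one_mul]
    refine ⟨fourierLagInv (rihaczek (u : G → ℂ) (v : G → ℂ)), ?_, rfl⟩
    exact Function.invFunOn_mem ⟨_, lagProduct_mem u v, fourierLag_lagProduct u v⟩

end KohnNirenberg

end TimeFrequency

end

noncomputable section

namespace TimeFrequency

universe u

/-! ### Stability properties of test functions -/

section SchwartzStability

variable {G : Type u} [Group G] [TopologicalSpace G]

/-! Everything reduces to the pointwise unitarity of the matrices φ_D(ξ, y), because every other
ingredient of D is already unitary. The inverse partial Fourier transform of R(u, v) is the lag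
product u(x) v(x y⁻¹)^*, which the measure-preserving substitution y = z⁻¹ x turns into the
elementary tensor u(x) v(z)^*. By Plancherel in either variable, both partial Fourier transforms are
isometric. On the ambiguity side D is therefore R followed by left multiplication by φ_D
(`exists_lag`).

(d) ⇒ (b): pairing D(u, v) with D(f, g) produces φ_D^* φ_D = I in front of F R(u, v), and the
remaining pairing of R(u, v) with R(f, g) separates into two factors. (b) ⇒ (a) is a specialization.

(a) ⇒ (d): for u(x) = d_ξ tr(ξ(x) m), the function F R(u, 𝟏) equals m at ξ and 0 at all other
classes. Pairing with D(δ_e, δ_y) is evaluation at (e, y⁻¹), so (a) reads tr(φ_D^* φ_D m) = tr m at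
(ξ, y⁻¹) for every matrix m (`distribution_transform_isotypicTest`).

(d) ⇒ (c): a^D is the Hilbert–Schmidt operator whose kernel has ambiguity transform φ_D^* F a, the
trace of a product of such operators is the inner product of their kernels
(`IsHilbertTensor.hasTrace`), and φ_D^* preserves that inner product. (c) ⇒ (d): symbols whose
ambiguity transform lives at a single ξ, with a free test function of y as weight, localize the
trace identity to tr(φ_D^* m φ_D) = tr m for all y and m.

The analytic basis is the Peter–Weyl theorem (`trigPoly_orthogonal`), obtained from the spectral
theorem for compact self-adjoint convolution operators, together with Schur orthogonality. These
give Plancherel (`hasSum_plancherel`) and the injectivity of the partial Fourier transforms.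
Condition (d) also needs φ_D(ξ, ·) to be a test function, which follows from the mapping property of
D (`isSchwartz_kernel`). -/

theorem IsSchwartz.add {u v : G → ℂ} (hu : IsSchwartz u) (hv : IsSchwartz v) :
    IsSchwartz fun x => u x + v x :=
  (SchwartzBruhat G).add_mem hu hv

theorem IsSchwartz.mul {u v : G → ℂ} (hu : IsSchwartz u) (hv : IsSchwartz v) :
    IsSchwartz fun x => u x * v x := by
  have : ContDiff ℝ ∞ fun p : ℂ × ℂ => p.1 * p.2 := by fun_prop
  exact IsSchwartz.map₂ hu hv this

theorem IsSchwartz.const (c : ℂ) : IsSchwartz fun _ : G => c := by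
  simpa using (SchwartzBruhat.one (G := G)).2.comp_left (φ := fun _ => c) contDiff_const

theorem IsSchwartz.conj {u : G → ℂ} (hu : IsSchwartz u) :
    IsSchwartz fun x => conj (u x) :=
  hu.comp_left Complex.conjCLE.contDiff

theorem IsSchwartz.sum {ι : Type*} (s : Finset ι) {u : ι → G → ℂ}
    (hu : ∀ i ∈ s, IsSchwartz (u i)) : IsSchwartz fun x => ∑ i ∈ s, u i x := by
  have := (SchwartzBruhat G).sum_mem (t := s) (f := u) hu
  rwa [show (∑ i ∈ s, u i) = fun x => ∑ i ∈ s, u i x from by ext; simp] at this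

theorem IsSchwartz.comp_hom {G' : Type*} [Group G'] [TopologicalSpace G'] {u : G → ℂ}
    (hu : IsSchwartz u) (φ : G' →ₜ* G) : IsSchwartz fun x => u (φ x) := by
  obtain ⟨ι, i1, i2, ρ, F, hF, h⟩ := hu
  exact ⟨ι, i1, i2, ρ.comp φ, F, hF, fun x => h (φ x)⟩

/-- For unitary ρ the matrix of x⁻¹ is the conjugate transpose of that of x. It depends smoothly on
the entries because smoothness is over ℝ. -/
theorem IsSchwartz.comp_inv {u : G → ℂ} (hu : IsSchwartz u) : IsSchwartz fun x => u x⁻¹ := by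
  obtain ⟨ι, i1, i2, ρ, F, hF, h⟩ := hu
  refine ⟨ι, i1, i2, ρ, fun A => F fun i j => conj (A j i), hF.comp ?_, fun x => ?_⟩
  · exact contDiff_pi.2 fun i => contDiff_pi.2 fun j => Complex.conjCLE.contDiff.comp (by fun_prop)
  · simp only [h, map_inv]
    rfl

theorem IsSchwartz.comp_mul_right {u : G → ℂ} (hu : IsSchwartz u) (a : G) :
    IsSchwartz fun x => u (x * a) := by
  obtain ⟨ι, i1, i2, ρ, F, hF, h⟩ := hu
  refine ⟨ι, i1, i2, ρ, fun A => F fun i j => ∑ k, A i k * entries (ρ a) k j, hF.comp ?_,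
    fun x => ?_⟩
  · fun_prop
  · simp only [h, map_mul]
    rfl

theorem IsSchwartz.comp_mul_left {u : G → ℂ} (hu : IsSchwartz u) (a : G) :
    IsSchwartz fun x => u (a * x) := by
  obtain ⟨ι, i1, i2, ρ, F, hF, h⟩ := hu
  refine ⟨ι, i1, i2, ρ, fun A => F fun i j => ∑ k, entries (ρ a) i k * A k j, hF.comp ?_,
    fun x => ?_⟩
  · fun_prop
  · simp only [h, map_mul]
    rfl

theorem UnitaryDual.continuous_mat (ξ : UnitaryDual G) : Continuous fun x => ξ.mat x :=
  UnitaryIrrep.continuous_mat _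

theorem UnitaryDual.isSchwartz_mat (ξ : UnitaryDual G) (i j : Fin ξ.dim) :
    IsSchwartz fun x => ξ.mat x i j :=
  ⟨Fin ξ.dim, inferInstance, inferInstance, (Quotient.out ξ : UnitaryIrrep G).rep,
    fun A => A i j, by fun_prop, fun _ => rfl⟩

end SchwartzStability

/-! ### Smooth parametric integrals -/

/-- An integral of a smooth function depending on a parameter in a compact set is smooth. -/
theorem contDiff_integral_of_compact {X : Type*} [TopologicalSpace X] [CompactSpace X]
    [MeasurableSpace X] [BorelSpace X] (μ : Measure X) [IsFiniteMeasure μ]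
    {P E : Type} [NormedAddCommGroup P] [NormedSpace ℝ P] [NormedAddCommGroup E]
    [NormedSpace ℝ E] [FiniteDimensional ℝ E] (θ : C(X, P)) (n : ℕ) :
    ∀ {V : Type} [NormedAddCommGroup V] [NormedSpace ℝ V] [FiniteDimensional ℝ V] {Φ : P × E → V},
      ContDiff ℝ ∞ Φ → ContDiff ℝ n fun B => ∫ x, Φ (θ x, B) ∂μ := by
  -- The target `V` stays quantified, since the induction hypothesis is applied to a derivative with
  -- values in `E →L[ℝ] V`.
  induction n with
  | zero =>
    intro V _ _ _ Φ hΦ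
    refine contDiff_zero.2 ?_
    have := hΦ.continuous
    simpa using continuous_parametric_integral_of_continuous (μ := μ) (s := Set.univ)
      (f := fun B x => Φ (θ x, B)) (by fun_prop) isCompact_univ
  | succ n ih =>
    intro V _ _ _ Φ hΦ
    have := FiniteDimensional.complete ℝ V
    let Ψ : P × E → E →L[ℝ] V := fun q => (fderiv ℝ Φ q).comp (ContinuousLinearMap.inr ℝ P E)
    have hΨ : ContDiff ℝ ∞ Ψ := (hΦ.fderiv_right (m := ∞) (by simp)).clm_comp contDiff_const
    have hd : ∀ B, HasFDerivAt (fun B => ∫ x, Φ (θ x, B) ∂μ) (∫ x, Ψ (θ x, B) ∂μ) B := by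
      intro B
      -- The parameters range over a compact set and closed balls of `E` are compact, so a constant
      -- dominates the derivative near `B`.
      have hc : IsCompact (Set.range θ ×ˢ Metric.closedBall B 1) :=
        (isCompact_range θ.continuous).prod (isCompact_closedBall B 1)
      obtain ⟨C, hC⟩ := hc.exists_bound_of_continuousOn hΨ.continuous.continuousOn
      have hcΦ := hΦ.continuous
      have hcΨ := hΨ.continuous
      have hsm : ∀ {W : Type} [NormedAddCommGroup W] {f : X → W}, Continuous f →
          Integrable f μ := fun {W} _ {f} hf => by
        refine hf.integrable_of_hasCompactSupport (HasCompactSupport.of_compactSpace _)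
      refine hasFDerivAt_integral_of_dominated_of_fderiv_le (bound := fun _ => C)
        (F' := fun B x => Ψ (θ x, B)) (Metric.closedBall_mem_nhds B one_pos) ?_ ?_ ?_ ?_ ?_ ?_
      · exact Filter.Eventually.of_forall fun B' =>
          (hsm (f := fun x => Φ (θ x, B')) (by fun_prop)).aestronglyMeasurable
      · exact hsm (by fun_prop)
      · exact (hsm (f := fun x => Ψ (θ x, B)) (by fun_prop)).aestronglyMeasurable
      · exact Filter.Eventually.of_forall fun x B' hB' => hC _ ⟨⟨x, rfl⟩, hB'⟩
      · exact integrable_const _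
      · refine Filter.Eventually.of_forall fun x B' _ => ?_
        have h1 := (hΦ.differentiable (by simp) (θ x, B')).hasFDerivAt
        exact h1.comp B' (hasFDerivAt_prodMk_right (θ x) B')
    rw [Nat.cast_succ, contDiff_succ_iff_hasFDerivAt]
    exact ⟨_, ih hΨ, hd⟩

/-- The weighted partial integrals of a test function on a product group are test functions. -/
theorem IsSchwartz.integral_fst {G : Type u} [Group G] [TopologicalSpace G]
    [IsTopologicalGroup G] [CompactSpace G] [MeasurableSpace G] [BorelSpace G]
    {w : G × G → ℂ} (hw : IsSchwartz w) {g : G → ℂ} (hg : Continuous g) :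
    IsSchwartz fun y => ∫ x, w (x, y) * g x ∂(haarProb G) := by
  obtain ⟨ι, i1, i2, ρ, F, hF, h⟩ := hw
  -- Writing (x, y) = (x, e)(e, y) gives ρ(x, y) = ρ(x, e) ρ(e, y), so `w` is smooth in the entries
  -- of ρ(e, y) with ρ(x, e) as parameter. The weight `g x` is only continuous and is carried as one
  -- more parameter coordinate.
  let θ : C(G, (ι → ι → ℂ) × ℂ) :=
    ⟨fun x => (entries (ρ (ContinuousMonoidHom.inl G G x)), g x), by
      have := continuous_entries (ι := ι)
      have := ρ.continuous_toFun
      have := (ContinuousMonoidHom.inl G G).continuous_toFun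
      exact (continuous_entries.comp (ρ.continuous_toFun.comp this)).prodMk hg⟩
  let Φ : ((ι → ι → ℂ) × ℂ) × (ι → ι → ℂ) → ℂ := fun q =>
    F (fun i j => ∑ k, q.1.1 i k * q.2 k j) * q.1.2
  have hΦ : ContDiff ℝ ∞ Φ := (hF.comp (by fun_prop)).mul (by fun_prop)
  refine ⟨ι, i1, i2, ρ.comp (ContinuousMonoidHom.inr G G),
    fun B => ∫ x, Φ (θ x, B) ∂(haarProb G), ?_, fun y => ?_⟩
  · exact contDiff_infty.2 fun n => contDiff_integral_of_compact _ θ n hΦ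
  · refine integral_congr_ae (Filter.Eventually.of_forall fun x => ?_)
    have : ((x, y) : G × G) = ContinuousMonoidHom.inl G G x * ContinuousMonoidHom.inr G G y := by
      ext <;> simp
    simp only [h, this, map_mul]
    rfl

/-! ### Hilbert tensor products and Hilbert--Schmidt operators -/

section HilbertTensor

variable {H : Type u} [NormedAddCommGroup H] [InnerProductSpace ℂ H]
  {K : Type*} [NormedAddCommGroup K] [InnerProductSpace ℂ K]

/-- `t u v` represents `u ⊗ v^*` in the Hilbert tensor product `K` of `H` and its conjugate. -/
structure IsHilbertTensor (t : H → H → K) : Prop where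
  inner_inner : ∀ u v u' v', inner ℂ (t u v) (t u' v') = inner ℂ u u' * inner ℂ v' v
  dense : (Submodule.span ℂ (Set.range fun p : H × H => t p.1 p.2)).topologicalClosure = ⊤

namespace IsHilbertTensor

variable {t : H → H → K} (ht : IsHilbertTensor t)
include ht

theorem norm_apply (u v : H) : ‖t u v‖ = ‖u‖ * ‖v‖ := by
  have h := ht.inner_inner u v u v
  simp only [inner_self_eq_norm_sq_to_K] at h
  norm_cast at h
  exact (sq_eq_sq₀ (norm_nonneg _) (by positivity)).1 (by rw [h, mul_pow])

/-- Sesquilinearity need not be assumed: the inner products of elementary tensors already force the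
squared norm of the defect to vanish. -/
theorem add_left (u u' v : H) : t (u + u') v = t u v + t u' v := by
  rw [← sub_eq_zero, ← inner_self_eq_zero (𝕜 := ℂ)]
  simp only [inner_sub_left, inner_sub_right, inner_add_left, inner_add_right, ht.inner_inner]
  ring

theorem add_right (u v v' : H) : t u (v + v') = t u v + t u v' := by
  rw [← sub_eq_zero, ← inner_self_eq_zero (𝕜 := ℂ)]
  simp only [inner_sub_left, inner_sub_right, inner_add_left, inner_add_right, ht.inner_inner]
  ring

theorem smul_left (c : ℂ) (u v : H) : t (c • u) v = c • t u v := by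
  rw [← sub_eq_zero, ← inner_self_eq_zero (𝕜 := ℂ)]
  simp only [inner_sub_left, inner_sub_right, inner_smul_left, inner_smul_right, ht.inner_inner]
  ring

theorem smul_right (c : ℂ) (u v : H) : t u (c • v) = conj c • t u v := by
  rw [← sub_eq_zero, ← inner_self_eq_zero (𝕜 := ℂ)]
  simp only [inner_sub_left, inner_sub_right, inner_smul_left, inner_smul_right, ht.inner_inner,
    Complex.conj_conj]
  ring

/-- The map `(v, u) ↦ u ⊗ v^*` as a continuous sesquilinear map. -/
def toCLM : H →L⋆[ℂ] H →L[ℂ] K :=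
  LinearMap.mkContinuous₂ (LinearMap.mk₂'ₛₗ (starRingEnd ℂ) (RingHom.id ℂ) (fun v u => t u v)
    (fun _ _ _ => ht.add_right _ _ _) (fun _ _ _ => ht.smul_right _ _ _)
    (fun _ _ _ => ht.add_left _ _ _) (fun _ _ _ => ht.smul_left _ _ _)) 1
    fun v u => by simp [ht.norm_apply, mul_comm]

@[simp] theorem toCLM_apply (u v : H) : ht.toCLM v u = t u v := rfl

/-- The orthonormal basis `e_i ⊗ e_j^*` of a Hilbert tensor product. -/
theorem orthonormal {ι : Type*} {e : ι → H} (he : Orthonormal ℂ e) :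
    Orthonormal ℂ fun p : ι × ι => t (e p.1) (e p.2) := by
  classical
  rw [orthonormal_iff_ite] at he ⊢
  rintro ⟨i, j⟩ ⟨i', j'⟩
  simp only [ht.inner_inner, he, Prod.mk.injEq]
  by_cases h1 : i = i' <;> by_cases h2 : j = j' <;> simp [h1, h2, eq_comm]

/-- Density is extended one slot at a time: with `e i` fixed in the first slot the second slot
ranges over `H` by continuity, and then the first slot does. -/
theorem span_basis_dense {ι : Type*} (e : HilbertBasis ι ℂ H) :
    (Submodule.span ℂ (Set.range fun p : ι × ι => t (e p.1) (e p.2))).topologicalClosure = ⊤ := by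
  set M := (Submodule.span ℂ (Set.range fun p : ι × ι => t (e p.1) (e p.2))).topologicalClosure
    with hM
  have hMc : IsClosed (M : Set K) := Submodule.isClosed_topologicalClosure _
  have h1 : ∀ i v, t (e i) v ∈ M := by
    intro i v
    have : (Submodule.span ℂ (Set.range e)).topologicalClosure ≤
        M.comap ((ht.toCLM.flip (e i)) : H →ₛₗ[starRingEnd ℂ] K) := by
      refine Submodule.topologicalClosure_minimal _ (Submodule.span_le.2 ?_)
        (hMc.preimage (ht.toCLM.flip (e i)).continuous)
      rintro _ ⟨j, rfl⟩
      exact Submodule.le_topologicalClosure _ (Submodule.subset_span ⟨(i, j), rfl⟩)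
    rw [e.dense_span] at this
    exact this (x := v) trivial
  have h2 : ∀ u v, t u v ∈ M := by
    intro u v
    have : (Submodule.span ℂ (Set.range e)).topologicalClosure ≤
        M.comap ((ht.toCLM v) : H →ₗ[ℂ] K) := by
      refine Submodule.topologicalClosure_minimal _ (Submodule.span_le.2 ?_)
        (hMc.preimage (ht.toCLM v).continuous)
      rintro _ ⟨j, rfl⟩
      exact h1 j v
    rw [e.dense_span] at this
    exact this (x := u) trivial
  rw [eq_top_iff, ← ht.dense]
  refine Submodule.topologicalClosure_minimal _ (Submodule.span_le.2 ?_) hMc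
  rintro _ ⟨p, rfl⟩
  exact h2 p.1 p.2

/-- The Hilbert basis `e_i ⊗ e_j^*` of a Hilbert tensor product. -/
def basis [CompleteSpace K] {ι : Type*} (e : HilbertBasis ι ℂ H) : HilbertBasis (ι × ι) ℂ K :=
  HilbertBasis.mk (ht.orthonormal e.orthonormal) (ht.span_basis_dense e).ge

@[simp] theorem basis_apply [CompleteSpace K] {ι : Type*} (e : HilbertBasis ι ℂ H) (p : ι × ι) :
    ht.basis e p = t (e p.1) (e p.2) := by
  simp [basis]

variable [CompleteSpace H]

/-- The Hilbert--Schmidt operator with kernel `k`. -/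
def op (k : K) : H →L[ℂ] H :=
  InnerProductSpace.continuousLinearMapOfBilin
    ((ContinuousLinearMap.compL ℂ H K ℂ (innerSL ℂ k)).comp ht.toCLM)

theorem inner_op (k : K) (u v : H) : inner ℂ (ht.op k v) u = inner ℂ k (t u v) := by
  simp [op]

theorem op_add (k l : K) : ht.op (k + l) = ht.op k + ht.op l := by
  ext v
  refine ext_inner_right ℂ fun u => ?_
  simp [ht.inner_op, inner_add_left]

theorem op_smul (c : ℂ) (k : K) : ht.op (c • k) = c • ht.op k := by
  ext v
  refine ext_inner_right ℂ fun u => ?_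
  simp [ht.inner_op, inner_smul_left, mul_comm]

/-- The correspondence between kernels and Hilbert--Schmidt operators. -/
def opL : K →L[ℂ] (H →L[ℂ] H) :=
  LinearMap.mkContinuous ⟨⟨ht.op, ht.op_add⟩, ht.op_smul⟩ 1 fun k => by
    refine ContinuousLinearMap.opNorm_le_bound _ (by positivity) fun v => ?_
    change ‖ht.op k v‖ ≤ _
    rcases eq_or_ne (ht.op k v) 0 with h | h
    · rw [h, norm_zero]; positivity
    -- Testing against the vector `ht.op k v` itself gives ‖op k v‖² ≤ ‖k‖ ‖op k v‖ ‖v‖.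
    · have h1 := ht.inner_op k (ht.op k v) v
      rw [inner_self_eq_norm_sq_to_K] at h1
      have h2 := norm_inner_le_norm (𝕜 := ℂ) k (t (ht.op k v) v)
      rw [← h1, ht.norm_apply] at h2
      have h3 : 0 < ‖ht.op k v‖ := norm_pos_iff.2 h
      simp only [norm_pow, RCLike.norm_ofReal, abs_norm] at h2
      refine le_of_mul_le_mul_right ?_ h3
      nlinarith

/-- Elementary tensors give operators of rank at most one. Their span is dense, `opL` is norm
continuous, and compact operators form a closed subspace. -/
theorem isCompactOperator_op (k : K) : IsCompactOperator (ht.op k) := by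
  have hc : IsClosed {k | IsCompactOperator (ht.opL k)} :=
    isClosed_setOfPred_isCompactOperator.preimage ht.opL.continuous
  let S : Submodule ℂ K :=
    { carrier := {k | IsCompactOperator (ht.opL k)}
      add_mem' := fun {a b} ha hb => by
        have := IsCompactOperator.add ha hb
        simpa using this
      zero_mem' := by
        have := isCompactOperator_zero (M₁ := H) (M₂ := H)
        simpa using this
      smul_mem' := fun c a ha => by
        have := IsCompactOperator.smul ha c
        simpa using this }
  suffices h : (⊤ : Submodule ℂ K) ≤ S from h (x := k) trivial
  rw [← ht.dense]
  refine Submodule.topologicalClosure_minimal _ (Submodule.span_le.2 ?_) hc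
  rintro _ ⟨⟨u, v⟩, rfl⟩
  have h1 : ht.op (t u v) = (ContinuousLinearMap.toSpanSingleton ℂ u).comp (innerSL ℂ v) := by
    ext x
    refine ext_inner_right ℂ fun y => ?_
    simp [ht.inner_op, ht.inner_inner, inner_smul_left, mul_comm]
  change IsCompactOperator (ht.op (t u v))
  rw [h1]
  exact IsCompactOperator.comp_clm (isCompactOperator_of_locallyCompactSpace_rng
    (ContinuousLinearMap.toSpanSingleton ℂ u)) (innerSL ℂ v)

/-- The trace of a product of Hilbert--Schmidt operators is the inner product of the kernels. -/
theorem hasTrace [CompleteSpace K] {A B : H →L[ℂ] H} {k l : K}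
    (hA : ∀ u v, inner ℂ (A v) u = inner ℂ k (t u v))
    (hB : ∀ u v, inner ℂ (B v) u = inner ℂ l (t u v)) :
    HasTrace (A ∘L ContinuousLinearMap.adjoint B) (inner ℂ l k) := by
  intro ι e
  -- Parseval in the basis e_i ⊗ e_j^* gives a double sum. For fixed i the sum over j is Parseval in
  -- `H` for ⟨A^* e_i, B^* e_i⟩, the i-th diagonal entry of A B^*.
  have h1 := (ht.basis e).hasSum_inner_mul_inner l k
  refine h1.prod_fiberwise fun i => ?_
  have h2 := e.hasSum_inner_mul_inner (ContinuousLinearMap.adjoint A (e i))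
    (ContinuousLinearMap.adjoint B (e i))
  rw [ContinuousLinearMap.adjoint_inner_left] at h2
  refine (congrArg (fun f => HasSum f _) (funext fun j => ?_)).mpr h2
  rw [basis_apply, ContinuousLinearMap.adjoint_inner_left, ContinuousLinearMap.adjoint_inner_right,
    ← inner_conj_symm _ k, ← hA, ← hB, inner_conj_symm, mul_comm]

end IsHilbertTensor

end HilbertTensor

/-! ### Square-integrable kernels on a compact space -/

section TensorLp

variable {X : Type*} [MeasurableSpace X] {μ : Measure X}

theorem memLp_tensor (u v : Lp ℂ 2 μ) :
    MemLp (fun p : X × X => u p.1 * conj (v p.2)) 2 (μ.prod μ) := by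
  have hu := Lp.memLp u
  have hv := Lp.memLp v
  have hm : AEStronglyMeasurable (fun p : X × X => u p.1 * conj (v p.2)) (μ.prod μ) :=
    hu.1.comp_fst.mul (Complex.continuous_conj.comp_aestronglyMeasurable hv.1.comp_snd)
  rw [memLp_two_iff_integrable_sq_norm hm]
  have := ((memLp_two_iff_integrable_sq_norm hu.1).1 hu).mul_prod
    ((memLp_two_iff_integrable_sq_norm hv.1).1 hv)
  simpa [mul_pow] using this

/-- The function `(x, z) ↦ u(x) v(z)^*` for square-integrable functions `u, v`. -/
def tensorLp (u v : Lp ℂ 2 μ) : Lp ℂ 2 (μ.prod μ) := (memLp_tensor u v).toLp _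

variable [SFinite μ]

theorem inner_tensorLp (u v u' v' : Lp ℂ 2 μ) :
    inner ℂ (tensorLp u v) (tensorLp u' v') = inner ℂ u u' * inner ℂ v' v := by
  have h : inner ℂ (tensorLp u v) (tensorLp u' v') =
      ∫ p, (u' p.1 * conj (u p.1)) * (v p.2 * conj (v' p.2)) ∂(μ.prod μ) := by
    refine integral_congr_ae ?_
    filter_upwards [(memLp_tensor u v).coeFn_toLp, (memLp_tensor u' v').coeFn_toLp] with p h1 h2
    simp only [tensorLp, h1, h2, RCLike.inner_apply, map_mul, Complex.conj_conj]
    ring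
  rw [h, integral_prod_mul (fun x => u' x * conj (u x)) (fun x => v x * conj (v' x))]
  rfl

variable (μ) in
/-- The closed span of the kernels `(x, z) ↦ u(x) v(z)^*`. -/
def kernelSubmodule : Submodule ℂ (Lp ℂ 2 (μ.prod μ)) :=
  (Submodule.span ℂ (Set.range fun p : Lp ℂ 2 μ × Lp ℂ 2 μ =>
    tensorLp p.1 p.2)).topologicalClosure

variable (μ) in
/-- The Hilbert space of square-integrable kernels. -/
def KernelSpace : Type _ := kernelSubmodule μ

instance : NormedAddCommGroup (KernelSpace μ) :=
  inferInstanceAs (NormedAddCommGroup (kernelSubmodule μ))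

instance : InnerProductSpace ℂ (KernelSpace μ) :=
  inferInstanceAs (InnerProductSpace ℂ (kernelSubmodule μ))

instance : CompleteSpace (KernelSpace μ) :=
  inferInstanceAs (CompleteSpace
    (Submodule.span ℂ (Set.range fun p : Lp ℂ 2 μ × Lp ℂ 2 μ =>
      tensorLp p.1 p.2)).topologicalClosure)

/-- The kernel `(x, z) ↦ u(x) v(z)^*`. -/
def tensor (u v : Lp ℂ 2 μ) : KernelSpace μ :=
  ⟨tensorLp u v, Submodule.le_topologicalClosure _ (Submodule.subset_span ⟨(u, v), rfl⟩)⟩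

theorem isHilbertTensor_tensor : IsHilbertTensor (tensor (μ := μ)) where
  inner_inner := inner_tensorLp
  dense := by
    refine eq_top_iff.2 fun x _ => ?_
    let T : Lp ℂ 2 μ × Lp ℂ 2 μ → kernelSubmodule μ := fun p => tensor p.1 p.2
    let S : Submodule ℂ (kernelSubmodule μ) := Submodule.span ℂ (Set.range T)
    have h : S.map (kernelSubmodule μ).subtype =
        Submodule.span ℂ (Set.range fun p : Lp ℂ 2 μ × Lp ℂ 2 μ => tensorLp p.1 p.2) := by
      rw [Submodule.map_span, ← Set.range_comp]
      rfl
    have h2 : Subtype.val '' (S : Set (kernelSubmodule μ)) =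
        (Submodule.span ℂ (Set.range fun p : Lp ℂ 2 μ × Lp ℂ 2 μ => tensorLp p.1 p.2) :
          Set (Lp ℂ 2 (μ.prod μ))) := by
      rw [← h]
      rfl
    have h3 (z : kernelSubmodule μ) : z ∈ closure (S : Set (kernelSubmodule μ)) := by
      rw [closure_subtype, h2]
      exact z.2
    exact h3 x

end TensorLp

/-! ### Continuous kernels and the Stone–Weierstrass theorem -/

section ContinuousKernels

variable {X : Type*} [TopologicalSpace X] [CompactSpace X]

/-- The function `(x, z) ↦ f(x) g(z)`. -/
def mulTensor (f g : C(X, ℂ)) : C(X × X, ℂ) := ⟨fun p => f p.1 * g p.2, by fun_prop⟩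

variable (X) in
/-- The star algebra of finite sums of functions `f(x) g(z)`. -/
def mulTensorAlgebra : StarSubalgebra ℂ C(X × X, ℂ) :=
  let S : Set C(X × X, ℂ) := Set.range fun p : C(X, ℂ) × C(X, ℂ) => mulTensor p.1 p.2
  { carrier := Submodule.span ℂ S
    add_mem' := Submodule.add_mem _
    mul_mem' := fun {a b} ha hb => by
      have h := Submodule.mul_mem_mul ha hb
      rw [Submodule.span_mul_span] at h
      refine Submodule.span_mono ?_ h
      rintro _ ⟨_, ⟨p, rfl⟩, _, ⟨q, rfl⟩, rfl⟩
      refine ⟨(p.1 * q.1, p.2 * q.2), ?_⟩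
      ext x
      simp only [mulTensor, ContinuousMap.coe_mk, ContinuousMap.mul_apply]
      ring
    algebraMap_mem' := fun c => by
      refine Submodule.subset_span ⟨(algebraMap ℂ _ c, 1), ?_⟩
      ext x
      simp [mulTensor]
    star_mem' := fun {a} ha => by
      refine Submodule.span_induction (p := fun a _ => star a ∈ Submodule.span ℂ S) ?_ ?_ ?_ ?_ ha
      · rintro _ ⟨p, rfl⟩
        refine Submodule.subset_span ⟨(star p.1, star p.2), ?_⟩
        ext x
        simp [mulTensor]
      · simp
      · intro a b _ _ ha hb
        rw [star_add]
        exact Submodule.add_mem _ ha hb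
      · intro c a _ ha
        rw [star_smul]
        exact Submodule.smul_mem _ _ ha }

/-- Stone–Weierstrass: a compact Hausdorff space is completely regular, so functions of one
coordinate separate the points of the product. -/
theorem mulTensorAlgebra_topologicalClosure [T2Space X] :
    (mulTensorAlgebra X).topologicalClosure = ⊤ := by
  refine ContinuousMap.starSubalgebra_topologicalClosure_eq_top_of_separatesPoints _ ?_
  intro p q hpq
  have key : ∀ a b : X, a ≠ b → ∃ f : C(X, ℂ), f a ≠ f b := by
    intro a b hab
    obtain ⟨f, hf, h⟩ := separatesPoints_continuous_of_t35Space hab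
    refine ⟨⟨fun x => (f x : ℂ), Complex.continuous_ofReal.comp hf⟩, ?_⟩
    simpa using h
  have hor : p.1 ≠ q.1 ∨ p.2 ≠ q.2 := by
    by_contra! h
    exact hpq (Prod.ext h.1 h.2)
  rcases hor with h | h
  · obtain ⟨f, hf⟩ := key _ _ h
    exact ⟨_, ⟨mulTensor f 1, Submodule.subset_span ⟨(f, 1), rfl⟩, rfl⟩, by simpa [mulTensor]⟩
  · obtain ⟨f, hf⟩ := key _ _ h
    exact ⟨_, ⟨mulTensor 1 f, Submodule.subset_span ⟨(1, f), rfl⟩, rfl⟩, by simpa [mulTensor]⟩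

variable [MeasurableSpace X] [BorelSpace X] {μ : Measure X} [IsProbabilityMeasure μ]

/-- When `X` is not second countable the product σ-algebra may be smaller than the Borel one, so
measurability of a continuous function on the product is not automatic; compact support supplies it.
-/
theorem memLp_continuous_prod (f : C(X × X, ℂ)) (p : ENNReal) : MemLp f p (μ.prod μ) :=
  MemLp.of_bound (HasCompactSupport.stronglyMeasurable_of_prod f.continuous
    (HasCompactSupport.of_compactSpace _)).aestronglyMeasurable ‖f‖
    (Filter.Eventually.of_forall fun x => f.norm_coe_le_norm x)

variable (μ) in
/-- Continuous kernels as square-integrable functions. -/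
def prodLp : C(X × X, ℂ) →L[ℂ] Lp ℂ 2 (μ.prod μ) :=
  LinearMap.mkContinuous
    { toFun := fun f => (memLp_continuous_prod f 2).toLp _
      map_add' := fun _ _ => rfl
      map_smul' := fun _ _ => rfl } 1 fun f => by
    have := Lp.norm_le_of_ae_bound (f := (memLp_continuous_prod (μ := μ) f 2).toLp _)
      (norm_nonneg f) (by
        filter_upwards [(memLp_continuous_prod (μ := μ) f 2).coeFn_toLp] with x hx
        rw [hx]
        exact f.norm_coe_le_norm x)
    simp only [measureUnivNNReal, measure_univ, ENNReal.toNNReal_one,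
      NNReal.coe_one, Real.one_rpow] at this
    exact this

theorem prodLp_mulTensor (f g : C(X, ℂ)) :
    prodLp μ (mulTensor f (star g)) =
      tensorLp (ContinuousMap.toLp 2 μ ℂ f) (ContinuousMap.toLp 2 μ ℂ g) := by
  refine (MemLp.toLp_eq_toLp_iff (memLp_continuous_prod _ 2) (memLp_tensor _ _)).2 ?_
  have hf := f.coeFn_toLp (p := 2) (𝕜 := ℂ) μ
  have hg := g.coeFn_toLp (p := 2) (𝕜 := ℂ) μ
  filter_upwards [Measure.quasiMeasurePreserving_fst.ae hf,
    Measure.quasiMeasurePreserving_snd.ae hg] with p h1 h2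
  rw [h1, h2]
  rfl

variable [T2Space X]

/-- Uniform convergence implies L² convergence on a probability space, so uniform approximation by
sums of products places every continuous kernel in the closed span of tensors. -/
theorem prodLp_mem (f : C(X × X, ℂ)) : prodLp μ f ∈ kernelSubmodule μ := by
  have h : f ∈ (mulTensorAlgebra X).topologicalClosure := by
    rw [mulTensorAlgebra_topologicalClosure]; trivial
  have hle : (Submodule.span ℂ (Set.range fun p : C(X, ℂ) × C(X, ℂ) =>
      mulTensor p.1 p.2)).topologicalClosure ≤ (kernelSubmodule μ).comap (prodLp μ : _ →ₗ[ℂ] _) := by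
    refine Submodule.topologicalClosure_minimal _ (Submodule.span_le.2 ?_)
      ((Submodule.isClosed_topologicalClosure _).preimage (prodLp μ).continuous)
    rintro _ ⟨p, rfl⟩
    have := prodLp_mulTensor (μ := μ) p.1 (star p.2)
    rw [star_star] at this
    change prodLp μ (mulTensor p.1 p.2) ∈ kernelSubmodule μ
    rw [this]
    exact (tensor (ContinuousMap.toLp 2 μ ℂ p.1) (ContinuousMap.toLp 2 μ ℂ (star p.2))).2
  exact hle h

variable (μ) in
/-- Continuous functions as kernels. -/
def contKernel : C(X × X, ℂ) →ₗ[ℂ] KernelSpace μ :=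
  LinearMap.codRestrict (kernelSubmodule μ) (prodLp μ : _ →ₗ[ℂ] _) prodLp_mem

theorem kernel_mulTensor (f g : C(X, ℂ)) :
    contKernel μ (mulTensor f (star g)) =
      tensor (ContinuousMap.toLp 2 μ ℂ f) (ContinuousMap.toLp 2 μ ℂ g) :=
  Subtype.ext (prodLp_mulTensor f g)

theorem inner_kernel (f g : C(X × X, ℂ)) :
    inner ℂ (contKernel μ f) (contKernel μ g) = ∫ x, ∫ z, g (x, z) * conj (f (x, z)) ∂μ ∂μ := by
  have h : inner ℂ (contKernel μ f) (contKernel μ g) = ∫ p, (g * star f) p ∂(μ.prod μ) := by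
    refine integral_congr_ae ?_
    filter_upwards [(memLp_continuous_prod (μ := μ) f 2).coeFn_toLp,
      (memLp_continuous_prod (μ := μ) g 2).coeFn_toLp] with p h1 h2
    change inner ℂ ((memLp_continuous_prod (μ := μ) f 2).toLp _ p)
      ((memLp_continuous_prod (μ := μ) g 2).toLp _ p) = _
    rw [h1, h2]
    rfl
  rw [h, integral_prod _ ((memLp_continuous_prod (μ := μ) _ 1).integrable le_rfl)]
  rfl

end ContinuousKernels

/-! ### Integral operators with continuous kernels -/

section IntegralOperators

variable {X : Type*} [TopologicalSpace X] [CompactSpace X] [MeasurableSpace X] [BorelSpace X]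
  {μ : Measure X} [IsProbabilityMeasure μ]

theorem integrable_of_continuous {E : Type*} [NormedAddCommGroup E] {f : X → E}
    (hf : Continuous f) : Integrable f μ :=
  hf.integrable_of_hasCompactSupport (HasCompactSupport.of_compactSpace _)

variable (μ) in
/-- The integral operator `v ↦ ∫ f(x, z) v(z) dz`, with continuous values. -/
def integralOperator (f : C(X × X, ℂ)) : Lp ℂ 2 μ →L[ℂ] C(X, ℂ) :=
  LinearMap.mkContinuous
    -- Pairing `v` with the slice at `x` defines a value at every point. It is continuous in `x`
    -- because the slice depends uniformly continuously on `x`, in the sup norm.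
    { toFun := fun v => ⟨fun x => inner ℂ (ContinuousMap.toLp 2 μ ℂ (star (f.curry x))) v,
        ((ContinuousMap.toLp 2 μ ℂ).continuous.comp
          (continuous_star.comp f.curry.continuous)).inner continuous_const⟩
      map_add' := fun v w => by ext x; simp [inner_add_right]
      map_smul' := fun c v => by ext x; simp [inner_smul_right] }
    (‖ContinuousMap.toLp (E := ℂ) 2 μ ℂ‖ * ‖f‖) fun v => by
    rw [ContinuousMap.norm_le _ (by positivity)]
    intro x
    refine (norm_inner_le_norm (𝕜 := ℂ) _ v).trans (mul_le_mul_of_nonneg_right ?_ (norm_nonneg v))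
    refine (ContinuousLinearMap.le_opNorm _ _).trans
      (mul_le_mul_of_nonneg_left ?_ (norm_nonneg _))
    rw [norm_star, ContinuousMap.norm_le _ (norm_nonneg _)]
    exact fun z => f.norm_coe_le_norm (x, z)

theorem integralOperator_toLp (f : C(X × X, ℂ)) (g : C(X, ℂ)) (x : X) :
    integralOperator μ f (ContinuousMap.toLp 2 μ ℂ g) x = ∫ z, g z * f (x, z) ∂μ := by
  change inner ℂ (ContinuousMap.toLp 2 μ ℂ (star (f.curry x))) (ContinuousMap.toLp 2 μ ℂ g) = _
  rw [ContinuousMap.inner_toLp]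
  refine integral_congr_ae (Filter.Eventually.of_forall fun z => ?_)
  simp

variable [T2Space X]

theorem inner_op_kernel_toLp (f : C(X × X, ℂ)) (u v : C(X, ℂ)) :
    inner ℂ (isHilbertTensor_tensor.op (contKernel μ f) (ContinuousMap.toLp 2 μ ℂ v))
      (ContinuousMap.toLp 2 μ ℂ u) = ∫ x, ∫ z, u x * conj (v z) * conj (f (x, z)) ∂μ ∂μ := by
  rw [isHilbertTensor_tensor.inner_op, ← kernel_mulTensor, inner_kernel]
  rfl

variable [μ.WeaklyRegular]

/-- This smoothing property turns L² eigenvectors for nonzero eigenvalues into continuous functions.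
Both sides are continuous in `v`, so it suffices to compare them for continuous `v` against
continuous functions. -/
theorem op_kernel (f : C(X × X, ℂ)) (v : Lp ℂ 2 μ) :
    isHilbertTensor_tensor.op (contKernel μ f) v =
      ContinuousMap.toLp 2 μ ℂ (integralOperator μ f v) := by
  have hd := ContinuousMap.toLp_denseRange (E := ℂ) μ ℂ (p := 2) (by simp)
  refine hd.induction_on v (isClosed_eq (ContinuousLinearMap.continuous _)
    ((ContinuousLinearMap.continuous _).comp (ContinuousLinearMap.continuous _))) fun g => ?_
  refine hd.eq_of_inner_left (𝕜 := ℂ) fun u => ?_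
  rw [inner_op_kernel_toLp, ContinuousMap.inner_toLp]
  refine integral_congr_ae (Filter.Eventually.of_forall fun x => ?_)
  simp only [integralOperator_toLp]
  rw [← integral_conj, ← integral_const_mul]
  refine integral_congr_ae (Filter.Eventually.of_forall fun z => ?_)
  simp only [map_mul]
  ring

theorem isSymmetric_op_kernel (f : C(X × X, ℂ)) (hf : ∀ x z, f (z, x) = conj (f (x, z))) :
    (isHilbertTensor_tensor.op (contKernel μ f)).IsSymmetric := by
  have hd := ContinuousMap.toLp_denseRange (E := ℂ) μ ℂ (p := 2) (by simp)
  intro a b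
  refine hd.induction_on₂ (isClosed_eq ?_ ?_) (fun v u => ?_) a b
  · exact ((ContinuousLinearMap.continuous _).comp continuous_fst).inner continuous_snd
  · exact continuous_fst.inner ((ContinuousLinearMap.continuous _).comp continuous_snd)
  · rw [← inner_conj_symm (ContinuousMap.toLp 2 μ ℂ v)]
    change inner ℂ (isHilbertTensor_tensor.op (contKernel μ f) _) _ =
      conj (inner ℂ (isHilbertTensor_tensor.op (contKernel μ f) _) _)
    rw [inner_op_kernel_toLp, inner_op_kernel_toLp, ← integral_conj,
      integral_integral_swap_of_hasCompactSupport
        (f := fun x z => u x * conj (v z) * conj (f (x, z))) (by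
          have := Complex.continuous_conj
          simp only [Function.uncurry_def]; fun_prop)
        (HasCompactSupport.of_compactSpace _)]
    refine integral_congr_ae (Filter.Eventually.of_forall fun x => ?_)
    simp only
    rw [← integral_conj]
    refine integral_congr_ae (Filter.Eventually.of_forall fun z => ?_)
    simp only [map_mul, Complex.conj_conj, hf x z]
    ring

end IntegralOperators

/-! ### Trigonometric polynomials -/

section Trigonometric

variable {G : Type u} [Group G] [TopologicalSpace G]

/-- The matrix coefficients of the representations `ξ ∈ Ĝ`. -/
def UnitaryDual.coef (ξ : UnitaryDual G) (i j : Fin ξ.dim) : C(G, ℂ) :=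
  ⟨fun x => ξ.mat x i j, ξ.continuous_mat.matrix_elem i j⟩

variable (G) in
/-- The space of trigonometric polynomials. -/
def trigPoly : Submodule ℂ C(G, ℂ) :=
  Submodule.span ℂ (Set.range fun p : Σ ξ : UnitaryDual G, Fin ξ.dim × Fin ξ.dim =>
    p.1.coef p.2.1 p.2.2)

theorem UnitaryDual.coef_mem (ξ : UnitaryDual G) (i j : Fin ξ.dim) : ξ.coef i j ∈ trigPoly G :=
  Submodule.subset_span ⟨⟨ξ, i, j⟩, rfl⟩

theorem UnitaryDual.mat_mul (ξ : UnitaryDual G) (x y : G) : ξ.mat (x * y) = ξ.mat x * ξ.mat y := by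
  simp only [UnitaryDual.mat, map_mul]
  rfl

theorem UnitaryDual.mat_one (ξ : UnitaryDual G) : ξ.mat 1 = 1 := by
  simp only [UnitaryDual.mat, map_one]
  rfl

theorem isSchwartz_of_mem_trigPoly {f : C(G, ℂ)} (hf : f ∈ trigPoly G) : IsSchwartz f := by
  refine Submodule.span_induction (p := fun (f : C(G, ℂ)) _ => IsSchwartz ⇑f) ?_ ?_ ?_ ?_ hf
  · rintro _ ⟨p, rfl⟩
    exact p.1.isSchwartz_mat _ _
  · exact IsSchwartz.const 0
  · exact fun a b _ _ ha hb => ha.add hb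
  · exact fun c a _ ha => (IsSchwartz.const c).mul ha

/-- A unitary equivalence expresses the coefficients of π as linear combinations of those of the
chosen representative of its class. -/
theorem UnitaryIrrep.coef_mem (π : UnitaryIrrep G) (i j : Fin π.dim) :
    (⟨fun x => (π.rep x : Matrix (Fin π.dim) (Fin π.dim) ℂ) i j,
      π.continuous_mat.matrix_elem i j⟩ : C(G, ℂ)) ∈ trigPoly G := by
  let ξ : UnitaryDual G := Quotient.mk _ π
  obtain ⟨U, h1, h2, h⟩ : ∃ U : Matrix (Fin π.dim) (Fin ξ.dim) ℂ, Uᴴ * U = 1 ∧ U * Uᴴ = 1 ∧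
      ∀ x, U * ξ.mat x = (π.rep x : Matrix (Fin π.dim) (Fin π.dim) ℂ) * U := Quotient.mk_out π
  have h3 : ∀ x, (π.rep x : Matrix (Fin π.dim) (Fin π.dim) ℂ) = U * ξ.mat x * Uᴴ := fun x => by
    rw [h x, Matrix.mul_assoc, h2, Matrix.mul_one]
  have h4 : (⟨fun x => (π.rep x : Matrix (Fin π.dim) (Fin π.dim) ℂ) i j,
      π.continuous_mat.matrix_elem i j⟩ : C(G, ℂ)) =
      ∑ l, ∑ k, (U i k * Uᴴ l j) • ξ.coef k l := by
    ext x
    simp only [ContinuousMap.coe_mk, h3, Matrix.mul_apply, ContinuousMap.coe_sum, Finset.sum_apply,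
      ContinuousMap.coe_smul, Pi.smul_apply, smul_eq_mul, Finset.sum_mul]
    refine Finset.sum_congr rfl fun l _ => Finset.sum_congr rfl fun k _ => ?_
    change U i k * ξ.mat x k l * Uᴴ l j = U i k * Uᴴ l j * ξ.mat x k l
    ring
  rw [h4]
  exact Submodule.sum_mem _ fun l _ => Submodule.sum_mem _ fun k _ =>
    Submodule.smul_mem _ _ (ξ.coef_mem k l)

variable [IsTopologicalGroup G]

/-- Right translation `f ↦ f(· g)`. -/
def rightTranslate (g : G) : C(G, ℂ) →ₗ[ℂ] C(G, ℂ) where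
  toFun f := f.comp ⟨fun x => x * g, by fun_prop⟩
  map_add' _ _ := rfl
  map_smul' _ _ := rfl

@[simp] theorem rightTranslate_apply (g x : G) (f : C(G, ℂ)) :
    rightTranslate g f x = f (x * g) := rfl

/-- Right translation invariant spaces of functions. -/
def IsRightInvariant (V : Submodule ℂ C(G, ℂ)) : Prop :=
  ∀ g, ∀ f ∈ V, rightTranslate g f ∈ V

theorem isRightInvariant_trigPoly : IsRightInvariant (trigPoly G) := by
  intro g f hf
  have : trigPoly G ≤ (trigPoly G).comap (rightTranslate g) := by
    refine Submodule.span_le.2 ?_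
    rintro _ ⟨⟨ξ, i, j⟩, rfl⟩
    change rightTranslate g (ξ.coef i j) ∈ trigPoly G
    have : rightTranslate g (ξ.coef i j) = ∑ k, ξ.mat g k j • ξ.coef i k := by
      ext x
      simp only [rightTranslate_apply, ContinuousMap.coe_sum, Finset.sum_apply,
        ContinuousMap.coe_smul, Pi.smul_apply, smul_eq_mul]
      change ξ.mat (x * g) i j = ∑ k, ξ.mat g k j * ξ.mat x i k
      simp only [ξ.mat_mul, Matrix.mul_apply, mul_comm]
    rw [this]
    exact Submodule.sum_mem _ fun k _ => Submodule.smul_mem _ _ (ξ.coef_mem i k)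
  exact this hf

variable [CompactSpace G] [MeasurableSpace G] [BorelSpace G]

/-- Continuous functions as elements of `L²(G)`. -/
abbrev toL2 : C(G, ℂ) →L[ℂ] Lp ℂ 2 (haarProb G) := ContinuousMap.toLp 2 (haarProb G) ℂ

theorem toL2_injective : Function.Injective (toL2 (G := G)) :=
  ContinuousMap.toLp_injective (haarProb G)

theorem inner_toL2 (f g : C(G, ℂ)) :
    inner ℂ (toL2 f) (toL2 g) = ∫ x, g x * conj (f x) ∂(haarProb G) :=
  ContinuousMap.inner_toLp _ f g

theorem inner_rightTranslate (g : G) (f h : C(G, ℂ)) :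
    inner ℂ (toL2 (rightTranslate g f)) (toL2 (rightTranslate g h)) =
      inner ℂ (toL2 f) (toL2 h) := by
  rw [inner_toL2, inner_toL2]
  exact integral_mul_right_eq_self (fun x => h x * conj (f x)) g

end Trigonometric

/-! ### The Peter--Weyl theorem -/

section PeterWeyl

variable {G : Type u} [Group G] [TopologicalSpace G] [IsTopologicalGroup G] [CompactSpace G]
  [MeasurableSpace G] [BorelSpace G]

/-- The matrix of right translations in an orthonormal family of functions. -/
def translationMatrix {n : ℕ} (f : Fin n → C(G, ℂ)) (g : G) : Matrix (Fin n) (Fin n) ℂ :=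
  Matrix.of fun i j => inner ℂ (toL2 (f i)) (toL2 (rightTranslate g (f j)))

theorem continuous_translationMatrix {n : ℕ} (f : Fin n → C(G, ℂ)) :
    Continuous (translationMatrix f) := by
  refine continuous_matrix fun i j => ?_
  let F : C(G × G, ℂ) := ⟨fun p => f j (p.2 * p.1), by fun_prop⟩
  exact continuous_const.inner (toL2.continuous.comp F.curry.continuous)

/-- Right translations preserve the L² inner product, hence the Gram matrix of the orthonormal
family. -/
theorem translationMatrix_mem_unitaryGroup {n : ℕ} {f : Fin n → C(G, ℂ)}
    (hf : Orthonormal ℂ fun i => toL2 (f i))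
    (h : ∀ g j, rightTranslate g (f j) = ∑ i, translationMatrix f g i j • f i) (g : G) :
    translationMatrix f g ∈ Matrix.unitaryGroup (Fin n) ℂ := by
  rw [Matrix.mem_unitaryGroup_iff', Matrix.star_eq_conjTranspose]
  ext i j
  have h1 := inner_rightTranslate g (f i) (f j)
  rw [h g i, h g j] at h1
  simp only [map_sum, map_smul] at h1
  rw [hf.inner_sum, orthonormal_iff_ite.1 hf] at h1
  rw [Matrix.mul_apply, Matrix.one_apply, ← h1]
  rfl

theorem translationMatrix_one {n : ℕ} {f : Fin n → C(G, ℂ)}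
    (hf : Orthonormal ℂ fun i => toL2 (f i)) : translationMatrix f 1 = 1 := by
  ext i j
  have : rightTranslate 1 (f j) = f j := by ext x; simp
  simp only [translationMatrix, Matrix.of_apply, this]
  rw [orthonormal_iff_ite.1 hf, Matrix.one_apply]

theorem translationMatrix_mul {n : ℕ} {f : Fin n → C(G, ℂ)}
    (h : ∀ g j, rightTranslate g (f j) = ∑ i, translationMatrix f g i j • f i) (a b : G) :
    translationMatrix f (a * b) = translationMatrix f a * translationMatrix f b := by
  ext i j
  have h1 : rightTranslate (a * b) (f j) = rightTranslate a (rightTranslate b (f j)) := by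
    ext x; simp [mul_assoc]
  have h2 : translationMatrix f (a * b) i j =
      inner ℂ (toL2 (f i)) (toL2 (rightTranslate (a * b) (f j))) := rfl
  rw [h2, h1, h b j, Matrix.mul_apply]
  simp only [map_sum, map_smul, inner_sum, inner_smul_right]
  exact Finset.sum_congr rfl fun k _ => mul_comm _ _

/-- The unitary representation by right translations on the span of an orthonormal family. -/
def translationRep {n : ℕ} (f : Fin n → C(G, ℂ))
    (hf : Orthonormal ℂ fun i => toL2 (f i))
    (h : ∀ g j, rightTranslate g (f j) = ∑ i, translationMatrix f g i j • f i) :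
    G →ₜ* Matrix.unitaryGroup (Fin n) ℂ where
  toFun g := ⟨translationMatrix f g, translationMatrix_mem_unitaryGroup hf h g⟩
  map_one' := Subtype.ext (translationMatrix_one hf)
  map_mul' a b := Subtype.ext (translationMatrix_mul h a b)
  continuous_toFun := (continuous_translationMatrix f).subtype_mk _

variable {V : Submodule ℂ C(G, ℂ)}

theorem exists_orthonormal_basis (V : Submodule ℂ C(G, ℂ)) [FiniteDimensional ℂ V] :
    ∃ (n : ℕ) (f : Fin n → C(G, ℂ)), (∀ i, f i ∈ V) ∧
      (Orthonormal ℂ fun i => toL2 (f i)) ∧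
      ∀ v ∈ V, v = ∑ i, (inner ℂ (toL2 (f i)) (toL2 v) : ℂ) • f i := by
  let W : Submodule ℂ (Lp ℂ 2 (haarProb G)) := V.map (toL2 (G := G) : C(G, ℂ) →ₗ[ℂ] _)
  have e : V ≃ₗ[ℂ] W := Submodule.equivMapOfInjective _ toL2_injective V
  have : FiniteDimensional ℂ W := Module.Finite.equiv e
  let b := (stdOrthonormalBasis ℂ W).reindex (finCongr e.finrank_eq.symm)
  have hb : ∀ i, ∃ f ∈ V, toL2 f = (b i : Lp ℂ 2 (haarProb G)) := fun i => (b i).2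
  choose f hfV hf using hb
  refine ⟨_, f, hfV, ?_, fun v hv => ?_⟩
  · simp only [hf]
    exact b.orthonormal.comp_linearIsometry W.subtypeₗᵢ
  · apply toL2_injective
    have := congrArg Subtype.val (b.sum_repr' ⟨toL2 v, ⟨v, hv, rfl⟩⟩)
    simp only [map_sum, map_smul, hf]
    simpa using this.symm

/-- Expanding the translate of f_j by x in the family and evaluating at the identity gives f_j(x) =
∑ f_i(1) π_ij(x), a combination of coefficients of an irreducible representation. -/
theorem mem_trigPoly_of_irreducible {n : ℕ} (hn : 0 < n) (f : Fin n → C(G, ℂ))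
    (hf : Orthonormal ℂ fun i => toL2 (f i))
    (h : ∀ g j, rightTranslate g (f j) = ∑ i, translationMatrix f g i j • f i)
    (hirr : ∀ M : Submodule ℂ (Fin n → ℂ), (∀ g, ∀ c ∈ M, translationMatrix f g *ᵥ c ∈ M) →
      M = ⊥ ∨ M = ⊤) (j : Fin n) : f j ∈ trigPoly G := by
  let π : UnitaryIrrep G := ⟨n, translationRep f hf h, hn, hirr⟩
  have h3 : f j = ∑ i, f i 1 • (⟨fun x => (π.rep x : Matrix (Fin n) (Fin n) ℂ) i j,
      π.continuous_mat.matrix_elem i j⟩ : C(G, ℂ)) := by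
    ext x
    have h4 := DFunLike.congr_fun (h x j) 1
    simp only [rightTranslate_apply, one_mul, ContinuousMap.coe_sum, Finset.sum_apply,
      ContinuousMap.coe_smul, Pi.smul_apply, smul_eq_mul] at h4 ⊢
    rw [h4]
    exact Finset.sum_congr rfl fun i _ => mul_comm _ _
  rw [h3]
  exact Submodule.sum_mem _ fun i _ => Submodule.smul_mem _ _ (π.coef_mem i j)

/-- Coordinates in an orthonormal basis carry invariant subspaces of ℂⁿ to invariant subspaces of
`V`, so minimality of `V` is irreducibility of its translation matrices. -/
theorem le_trigPoly_of_minimal (hV : IsRightInvariant V) [FiniteDimensional ℂ V] (h0 : V ≠ ⊥)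
    (hmin : ∀ W ≤ V, IsRightInvariant W → W ≠ ⊥ → W = V) : V ≤ trigPoly G := by
  obtain ⟨n, f, hfV, hf, hsum⟩ := exists_orthonormal_basis V
  have hpos : 0 < n := by
    refine Nat.pos_of_ne_zero ?_
    rintro rfl
    exact h0 ((Submodule.eq_bot_iff _).2 fun v hv => by simpa using hsum v hv)
  have h : ∀ g j, rightTranslate g (f j) = ∑ i, translationMatrix f g i j • f i := fun g j =>
    hsum _ (hV g _ (hfV j))
  have hlin : LinearIndependent ℂ f := by
    rw [Fintype.linearIndependent_iff]
    intro c hc i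
    have h1 := congrArg toL2 hc
    simp only [map_sum, map_smul, map_zero] at h1
    exact Fintype.linearIndependent_iff.1 hf.linearIndependent c h1 i
  obtain ⟨T, hT, hTe⟩ : ∃ T : (Fin n → ℂ) →ₗ[ℂ] C(G, ℂ), Function.Injective T ∧
      ∀ c, T c = ∑ i, c i • f i :=
    ⟨Fintype.linearCombination ℂ f, hlin.fintypeLinearCombination_injective,
      fun c => Fintype.linearCombination_apply ℂ f c⟩
  have hTtr : ∀ g c, rightTranslate g (T c) = T (translationMatrix f g *ᵥ c) := by
    intro g c
    simp only [hTe, map_sum, map_smul, h, Matrix.mulVec, dotProduct, Finset.smul_sum,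
      Finset.sum_smul, smul_smul]
    rw [Finset.sum_comm]
    simp only [mul_comm]
  have hTrange : ∀ c, T c ∈ V := fun c => by
    rw [hTe]
    exact Submodule.sum_mem _ fun i _ => V.smul_mem _ (hfV i)
  have hirr : ∀ M : Submodule ℂ (Fin n → ℂ), (∀ g, ∀ c ∈ M, translationMatrix f g *ᵥ c ∈ M) →
      M = ⊥ ∨ M = ⊤ := by
    intro M hM
    by_cases hM0 : M = ⊥
    · exact Or.inl hM0
    refine Or.inr ?_
    have h1 : M.map T = V := by
      refine hmin _ ?_ ?_ ?_
      · rintro _ ⟨c, _, rfl⟩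
        exact hTrange c
      · rintro g _ ⟨c, hc, rfl⟩
        exact ⟨_, hM g c hc, (hTtr g c).symm⟩
      · intro h2
        refine hM0 ((Submodule.eq_bot_iff _).2 fun c hc => hT ?_)
        rw [map_zero]
        exact (Submodule.eq_bot_iff _).1 h2 _ ⟨c, hc, rfl⟩
    refine eq_top_iff.2 fun c _ => ?_
    have h2 : T c ∈ M.map T := by
      rw [h1]
      exact hTrange c
    obtain ⟨d, hd, hdc⟩ := h2
    rw [← hT hdc]
    exact hd
  intro v hv
  rw [hsum v hv]
  exact Submodule.sum_mem _ fun j _ => Submodule.smul_mem _ _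
    (mem_trigPoly_of_irreducible hpos f hf h hirr j)

omit [CompactSpace G] [MeasurableSpace G] [BorelSpace G] in
theorem exists_minimal_invariant (hV : IsRightInvariant V) [FiniteDimensional ℂ V] (h0 : V ≠ ⊥) :
    ∃ W ≤ V, IsRightInvariant W ∧ W ≠ ⊥ ∧
      ∀ U ≤ W, IsRightInvariant U → U ≠ ⊥ → U = W := by
  obtain ⟨W, ⟨h1, h2, h3⟩, h4⟩ := (measure fun W : Submodule ℂ C(G, ℂ) =>
    Module.finrank ℂ W).wf.has_min {W | W ≤ V ∧ IsRightInvariant W ∧ W ≠ ⊥} ⟨V, le_rfl, hV, h0⟩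
  refine ⟨W, h1, h2, h3, fun U hU hi hU0 => ?_⟩
  by_contra hne
  have : FiniteDimensional ℂ W := Submodule.finiteDimensional_of_le h1
  exact h4 U ⟨hU.trans h1, hi, hU0⟩ (Submodule.finrank_lt_finrank_of_lt (lt_of_le_of_ne hU hne))

/-- Finite-dimensional right invariant spaces consist of trigonometric polynomials. -/
theorem le_trigPoly_of_finiteDimensional (hV : IsRightInvariant V) [FiniteDimensional ℂ V] :
    V ≤ trigPoly G := by
  let V₀ := V ⊓ trigPoly G
  have : FiniteDimensional ℂ V₀ := Submodule.finiteDimensional_of_le inf_le_left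
  have hV₀ : IsRightInvariant V₀ := fun g f hf =>
    ⟨hV g f hf.1, isRightInvariant_trigPoly g f hf.2⟩
  let V' : Submodule ℂ C(G, ℂ) :=
    { carrier := {f | f ∈ V ∧ ∀ h ∈ V₀, inner ℂ (toL2 h) (toL2 f) = 0}
      add_mem' := fun {a b} ha hb => ⟨V.add_mem ha.1 hb.1, fun h hh => by
        rw [map_add, inner_add_right, ha.2 h hh, hb.2 h hh, add_zero]⟩
      zero_mem' := ⟨V.zero_mem, by simp⟩
      smul_mem' := fun c a ha => ⟨V.smul_mem c ha.1, fun h hh => by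
        rw [map_smul, inner_smul_right, ha.2 h hh, mul_zero]⟩ }
  have hV' : IsRightInvariant V' := fun g f hf => ⟨hV g f hf.1, fun h hh => by
    have h1 : h = rightTranslate g (rightTranslate g⁻¹ h) := by ext x; simp
    rw [h1, inner_rightTranslate]
    exact hf.2 _ (hV₀ g⁻¹ h hh)⟩
  have hle : V' ≤ V := fun f hf => hf.1
  have : FiniteDimensional ℂ V' := Submodule.finiteDimensional_of_le hle
  -- A nonzero `V'` would contain a minimal invariant subspace. Its elements are trigonometric
  -- polynomials in `V`, hence lie in `V₀`, and so would be orthogonal to themselves.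
  have h0 : V' = ⊥ := by
    by_contra hne
    obtain ⟨W, h1, h2, h3, h4⟩ := exists_minimal_invariant hV' hne
    have : FiniteDimensional ℂ W := Submodule.finiteDimensional_of_le h1
    have h5 := le_trigPoly_of_minimal h2 h3 h4
    refine h3 (eq_bot_iff.2 fun f hf => ?_)
    have h6 := (h1 hf).2 f ⟨(h1 hf).1, h5 hf⟩
    rw [inner_self_eq_zero] at h6
    exact toL2_injective (h6.trans (map_zero _).symm)
  intro v hv
  obtain ⟨n, f, hfV, hf, hsum⟩ := exists_orthonormal_basis V₀
  -- The L² projection of `v` to `V₀`; the remainder lies in `V'`, which is zero.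
  let p : C(G, ℂ) := ∑ i, (inner ℂ (toL2 (f i)) (toL2 v) : ℂ) • f i
  have hp : p ∈ V₀ := Submodule.sum_mem _ fun i _ => V₀.smul_mem _ (hfV i)
  have h1 : v - p ∈ V' := by
    refine ⟨V.sub_mem hv hp.1, fun h hh => ?_⟩
    rw [hsum h hh]
    simp only [map_sum, map_smul, sum_inner, inner_smul_left]
    refine Finset.sum_eq_zero fun i _ => ?_
    have : inner ℂ (toL2 (f i)) (toL2 p) = (inner ℂ (toL2 (f i)) (toL2 v) : ℂ) := by
      simp only [p, map_sum, map_smul]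
      exact hf.inner_right_fintype _ i
    rw [map_sub, inner_sub_right, this, sub_self, mul_zero]
  rw [h0, Submodule.mem_bot, sub_eq_zero] at h1
  exact h1 ▸ hp.2

variable [T2Space G]

/-- Eigenfunctions of the convolution operator with a Hermitian kernel are trigonometric
polynomials. -/
theorem eigenspace_le_trigPoly (k : C(G, ℂ)) {c : ℂ} (hc : c ≠ 0) {v : Lp ℂ 2 (haarProb G)}
    (hv : v ∈ Module.End.eigenspace (isHilbertTensor_tensor.op (contKernel (haarProb G)
      ⟨fun p => k (p.1 * p.2⁻¹), by fun_prop⟩) : Module.End ℂ (Lp ℂ 2 (haarProb G))) c) :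
    v ∈ (trigPoly G).map (toL2 (G := G) : C(G, ℂ) →ₗ[ℂ] _) := by
  set f : C(G × G, ℂ) := ⟨fun p => k (p.1 * p.2⁻¹), by fun_prop⟩ with hf
  let V : Submodule ℂ C(G, ℂ) := (Module.End.eigenspace (isHilbertTensor_tensor.op
    (contKernel (haarProb G) f) : Module.End ℂ (Lp ℂ 2 (haarProb G))) c).comap
    (toL2 (G := G) : C(G, ℂ) →ₗ[ℂ] _)
  have hmem : ∀ u : C(G, ℂ), u ∈ V ↔ integralOperator (haarProb G) f (toL2 u) = c • u := by
    intro u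
    change toL2 u ∈ Module.End.eigenspace _ c ↔ _
    rw [Module.End.mem_eigenspace_iff]
    change isHilbertTensor_tensor.op (contKernel (haarProb G) f) (toL2 u) = _ ↔ _
    rw [op_kernel, ← map_smul]
    exact toL2_injective.eq_iff
  -- The kernel k(x z⁻¹) is unchanged when x and z are both multiplied on the right by g, so the
  -- operator commutes with right translations.
  have hinv : IsRightInvariant V := by
    intro g u hu
    rw [hmem] at hu ⊢
    ext x
    have h1 := DFunLike.congr_fun hu (x * g)
    rw [integralOperator_toLp] at h1 ⊢
    simp only [rightTranslate_apply, ContinuousMap.smul_apply] at h1 ⊢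
    rw [← h1]
    refine Eq.trans ?_ (integral_mul_right_eq_self (fun z => u z * f (x * g, z)) g)
    refine integral_congr_ae (Filter.Eventually.of_forall fun z => ?_)
    simp [hf, mul_assoc]
  have hfin : FiniteDimensional ℂ V := by
    have := ContinuousLinearMap.finite_dimensional_eigenspace
      (isHilbertTensor_tensor.isCompactOperator_op (contKernel (haarProb G) f)) c hc
    let L : V →ₗ[ℂ] Module.End.eigenspace (isHilbertTensor_tensor.op
      (contKernel (haarProb G) f) : Module.End ℂ (Lp ℂ 2 (haarProb G))) c :=
      LinearMap.codRestrict _ ((toL2 (G := G)).toLinearMap.comp V.subtype) fun x => x.2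
    refine FiniteDimensional.of_injective L fun a b hab => ?_
    exact Subtype.ext (toL2_injective (congrArg Subtype.val hab))
  rw [Module.End.mem_eigenspace_iff] at hv
  change isHilbertTensor_tensor.op (contKernel (haarProb G) f) v = _ at hv
  rw [op_kernel] at hv
  -- Since c ≠ 0, the eigenvector is c⁻¹ times its image under the operator, and so has a continuous
  -- representative.
  have h1 : toL2 (c⁻¹ • integralOperator (haarProb G) f v) = v := by
    rw [map_smul, hv, smul_smul, inv_mul_cancel₀ hc, one_smul]
  refine ⟨c⁻¹ • integralOperator (haarProb G) f v, le_trigPoly_of_finiteDimensional hinv ?_, h1⟩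
  rw [hmem, h1, smul_smul, mul_inv_cancel₀ hc, one_smul]

/-- The **Peter--Weyl theorem**: trigonometric polynomials are dense in `L²(G)`. -/
theorem trigPoly_orthogonal :
    ((trigPoly G).map (toL2 (G := G) : C(G, ℂ) →ₗ[ℂ] Lp ℂ 2 (haarProb G)))ᗮ = ⊥ := by
  refine (Submodule.eq_bot_iff _).2 fun u hu => ?_
  -- For such k the convolution operator T is compact and self-adjoint. Eigenvectors for nonzero
  -- eigenvalues are trigonometric polynomials, hence orthogonal to u. Thus T u is orthogonal to all
  -- eigenspaces and vanishes.
  have key : ∀ k : C(G, ℂ), (∀ x, k x⁻¹ = conj (k x)) →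
      inner ℂ (toL2 k) u = 0 := by
    intro k hk
    set f : C(G × G, ℂ) := ⟨fun p => k (p.1 * p.2⁻¹), by fun_prop⟩ with hf
    set T := isHilbertTensor_tensor.op (contKernel (haarProb G) f) with hT
    have hsym : T.IsSymmetric := isSymmetric_op_kernel f fun x z => by
      simp [hf, ← hk]
    have hTu : T u = 0 := by
      have h1 := ContinuousLinearMap.orthogonalComplement_iSup_eigenspaces_eq_bot
        (isHilbertTensor_tensor.isCompactOperator_op (contKernel (haarProb G) f)) hsym
      rw [← Submodule.mem_bot (R := ℂ), ← h1, ← Submodule.iInf_orthogonal, Submodule.mem_iInf]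
      intro c w hw
      have h2 := hsym w u
      have h3 : T w = c • w := Module.End.mem_eigenspace_iff.1 hw
      change inner ℂ (T w) u = inner ℂ w (T u) at h2
      rw [← h2, h3, inner_smul_left]
      rcases eq_or_ne c 0 with rfl | hc
      · simp
      · rw [hu w (eigenspace_le_trigPoly k hc hw), mul_zero]
    rw [hT, op_kernel] at hTu
    -- T u is a continuous function, and its value at the identity is ∫ k(z⁻¹) u(z) dz = ⟨k, u⟩ in
    -- the L² inner product.
    have h2 := DFunLike.congr_fun (toL2_injective (hTu.trans (map_zero toL2).symm)) 1
    change inner ℂ (toL2 (star (f.curry 1))) u = 0 at h2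
    rwa [show star (f.curry 1) = k from by ext z; simp [hf, hk]] at h2
  have hd := ContinuousMap.toLp_denseRange (E := ℂ) (haarProb G) ℂ (p := 2) (by simp)
  refine hd.eq_zero_of_inner_right (𝕜 := ℂ) fun k => ?_
  -- An arbitrary k splits into two parts with the symmetry required by `key`, as k = (k + k')/2 + i
  -- · (i(k' − k)/2).
  let k' : C(G, ℂ) := ⟨fun x => conj (k x⁻¹), Complex.continuous_conj.comp (by fun_prop)⟩
  have h1 := key ((2⁻¹ : ℂ) • (k + k')) fun x => by
    simp [k', add_comm, Complex.conj_ofNat]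
  have h2 := key ((2⁻¹ * Complex.I : ℂ) • (k' - k)) fun x => by
    simp only [k', ContinuousMap.smul_apply, ContinuousMap.sub_apply, ContinuousMap.coe_mk,
      inv_inv, smul_eq_mul, map_mul, map_sub, map_inv₀, Complex.conj_I, Complex.conj_conj]
    simp only [Complex.conj_ofNat]
    ring
  have h3 : k = (2⁻¹ : ℂ) • (k + k') + Complex.I • ((2⁻¹ * Complex.I : ℂ) • (k' - k)) := by
    rw [smul_smul, show Complex.I * (2⁻¹ * Complex.I) = -2⁻¹ by
      rw [mul_left_comm, Complex.I_mul_I]; ring]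
    module
  rw [h3, map_add, map_smul _ Complex.I, inner_add_left, inner_smul_left]
  change inner ℂ (toL2 _) u + _ * inner ℂ (toL2 _) u = 0
  rw [h1, h2, mul_zero, add_zero]

end PeterWeyl

/-! ### Schur orthogonality -/

section Schur

variable {G : Type u} [Group G] [TopologicalSpace G]

theorem UnitaryDual.dim_pos (ξ : UnitaryDual G) : 0 < ξ.dim := (Quotient.out ξ).dim_pos

theorem UnitaryDual.dim_ne_zero (ξ : UnitaryDual G) : (ξ.dim : ℂ) ≠ 0 :=
  Nat.cast_ne_zero.2 ξ.dim_pos.ne'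

theorem UnitaryDual.mat_mul_conjTranspose (ξ : UnitaryDual G) (x : G) :
    ξ.mat x * (ξ.mat x)ᴴ = 1 :=
  Matrix.mem_unitaryGroup_iff.1 ((Quotient.out ξ : UnitaryIrrep G).rep x).2

theorem UnitaryDual.conjTranspose_mul_mat (ξ : UnitaryDual G) (x : G) :
    (ξ.mat x)ᴴ * ξ.mat x = 1 :=
  Matrix.mem_unitaryGroup_iff'.1 ((Quotient.out ξ : UnitaryIrrep G).rep x).2

theorem UnitaryDual.irreducible (ξ : UnitaryDual G) (V : Submodule ℂ (Fin ξ.dim → ℂ))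
    (hV : ∀ x, ∀ v ∈ V, ξ.mat x *ᵥ v ∈ V) : V = ⊥ ∨ V = ⊤ :=
  (Quotient.out ξ : UnitaryIrrep G).irreducible V hV

/-- **Schur's lemma**: matrices commuting with an irreducible representation are scalar. -/
theorem UnitaryDual.exists_eq_smul_one (ξ : UnitaryDual G) (A : Matrix (Fin ξ.dim) (Fin ξ.dim) ℂ)
    (hA : ∀ x, ξ.mat x * A = A * ξ.mat x) : ∃ c : ℂ, A = c • 1 := by
  have : Nonempty (Fin ξ.dim) := ⟨⟨0, ξ.dim_pos⟩⟩
  obtain ⟨c, hc⟩ := Module.End.exists_eigenvalue A.mulVecLin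
  refine ⟨c, ?_⟩
  have hmem : ∀ v, v ∈ Module.End.eigenspace A.mulVecLin c ↔ A *ᵥ v = c • v := fun v =>
    Module.End.mem_eigenspace_iff
  rcases ξ.irreducible (Module.End.eigenspace A.mulVecLin c) (fun x v hv => by
      rw [hmem] at hv ⊢
      rw [Matrix.mulVec_mulVec, ← hA, ← Matrix.mulVec_mulVec, hv, Matrix.mulVec_smul]) with h | h
  · exact absurd h hc
  · refine Matrix.ext_of_mulVec_single fun i => ?_
    rw [(hmem (Pi.single i 1)).1 (h ▸ trivial), Matrix.smul_mulVec, Matrix.one_mulVec]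

open scoped ComplexOrder in
/-- **Schur's lemma**: inequivalent irreducible representations have no intertwiners. -/
theorem UnitaryDual.eq_of_intertwiner {ξ η : UnitaryDual G}
    (A : Matrix (Fin ξ.dim) (Fin η.dim) ℂ) (hA : ∀ x, ξ.mat x * A = A * η.mat x) (h0 : A ≠ 0) :
    ξ = η := by
  have hA' : ∀ x, η.mat x * Aᴴ = Aᴴ * ξ.mat x := fun x => by
    have h1 := congrArg conjTranspose (hA x)
    simp only [conjTranspose_mul] at h1
    calc η.mat x * Aᴴ = η.mat x * (Aᴴ * (ξ.mat x)ᴴ) * ξ.mat x := by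
          rw [Matrix.mul_assoc, Matrix.mul_assoc Aᴴ, ξ.conjTranspose_mul_mat, Matrix.mul_one]
      _ = _ := by
          rw [h1, ← Matrix.mul_assoc, η.mat_mul_conjTranspose, Matrix.one_mul]
  -- A^* A and A A^* commute with irreducible representations, so both are scalar. The scalars agree
  -- since A ≠ 0, the common value is positive, and dividing A by its square root gives a unitary
  -- equivalence.
  obtain ⟨c, hc⟩ := η.exists_eq_smul_one (Aᴴ * A) fun x => by
    rw [← Matrix.mul_assoc, hA', Matrix.mul_assoc, hA, Matrix.mul_assoc]
  obtain ⟨c', hc'⟩ := ξ.exists_eq_smul_one (A * Aᴴ) fun x => by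
    rw [← Matrix.mul_assoc, hA, Matrix.mul_assoc, hA', Matrix.mul_assoc]
  have hcc : c = c' := by
    have h1 : c • A = c' • A := by
      have h2 : A * (Aᴴ * A) = (A * Aᴴ) * A := (Matrix.mul_assoc _ _ _).symm
      rw [hc, hc'] at h2
      simpa using h2
    by_contra hne
    have h2 : (c - c') • A = 0 := by rw [sub_smul, h1, sub_self]
    exact h0 ((smul_eq_zero.1 h2).resolve_left (sub_ne_zero.2 hne))
  have hcpos : 0 < c := by
    let j : Fin η.dim := ⟨0, η.dim_pos⟩
    have h1 : 0 ≤ c := by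
      have h2 := (Matrix.posSemidef_conjTranspose_mul_self A).diag_nonneg (i := j)
      rw [hc] at h2
      simpa using h2
    refine lt_of_le_of_ne h1 fun h2 => h0 ?_
    rw [← h2, zero_smul] at hc
    exact Matrix.conjTranspose_mul_self_eq_zero.1 hc
  obtain ⟨r, hr, rfl⟩ : ∃ r : ℝ, 0 < r ∧ c = r := by
    rw [Complex.lt_def] at hcpos
    exact ⟨c.re, hcpos.1, Complex.ext rfl hcpos.2.symm⟩
  have hs : ((Real.sqrt r : ℝ) : ℂ)⁻¹ * ((Real.sqrt r : ℝ) : ℂ)⁻¹ * r = 1 := by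
    rw [← mul_inv, ← Complex.ofReal_mul, Real.mul_self_sqrt hr.le,
      inv_mul_cancel₀ (Complex.ofReal_ne_zero.2 hr.ne')]
  have hequiv : (Quotient.out η : UnitaryIrrep G) ≈ Quotient.out ξ := by
    refine ⟨((Real.sqrt r : ℝ) : ℂ)⁻¹ • A, ?_, ?_, fun x => ?_⟩
    · change (((Real.sqrt r : ℝ) : ℂ)⁻¹ • A)ᴴ * (((Real.sqrt r : ℝ) : ℂ)⁻¹ • A) = 1
      rw [conjTranspose_smul, Matrix.smul_mul, Matrix.mul_smul, hc, smul_smul, smul_smul]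
      simp only [star_inv₀, Complex.star_def, Complex.conj_ofReal]
      rw [hs, one_smul]
    · change (((Real.sqrt r : ℝ) : ℂ)⁻¹ • A) * (((Real.sqrt r : ℝ) : ℂ)⁻¹ • A)ᴴ = 1
      rw [conjTranspose_smul, Matrix.smul_mul, Matrix.mul_smul, hc', ← hcc, smul_smul, smul_smul]
      simp only [star_inv₀, Complex.star_def, Complex.conj_ofReal]
      rw [hs, one_smul]
    · change (((Real.sqrt r : ℝ) : ℂ)⁻¹ • A) * η.mat x = ξ.mat x * (((Real.sqrt r : ℝ) : ℂ)⁻¹ • A)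
      rw [Matrix.smul_mul, Matrix.mul_smul, hA]
  exact (Quotient.out_equiv_out.1 hequiv).symm

theorem continuous_conjugation (ξ η : UnitaryDual G) (M : Matrix (Fin ξ.dim) (Fin η.dim) ℂ) :
    Continuous fun x => ξ.mat x * M * (η.mat x)ᴴ :=
  (ξ.continuous_mat.matrix_mul continuous_const).matrix_mul η.continuous_mat.matrix_conjTranspose

theorem sqrt_dim_mul_self (ξ : UnitaryDual G) :
    ((Real.sqrt ξ.dim : ℝ) : ℂ) * ((Real.sqrt ξ.dim : ℝ) : ℂ) = ξ.dim := by
  rw [← Complex.ofReal_mul, Real.mul_self_sqrt (Nat.cast_nonneg _), Complex.ofReal_natCast]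

variable [IsTopologicalGroup G] [CompactSpace G] [MeasurableSpace G] [BorelSpace G]

/-- The entrywise integral of a matrix-valued function. -/
def matIntegral {m n : Type*} (F : G → Matrix m n ℂ) : Matrix m n ℂ :=
  Matrix.of fun i j => ∫ x, F x i j ∂(haarProb G)

theorem mul_matIntegral {l m n : Type*} [Fintype m] {F : G → Matrix m n ℂ} (hF : Continuous F)
    (A : Matrix l m ℂ) : A * matIntegral F = matIntegral fun x => A * F x := by
  ext i j
  simp only [matIntegral, Matrix.mul_apply, Matrix.of_apply, ← integral_const_mul]
  exact (integral_finsetSum _ fun k _ => integrable_of_continuous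
    (continuous_const.mul (hF.matrix_elem k j))).symm

theorem matIntegral_mul {l m n : Type*} [Fintype m] {F : G → Matrix l m ℂ} (hF : Continuous F)
    (A : Matrix m n ℂ) : matIntegral F * A = matIntegral fun x => F x * A := by
  ext i j
  simp only [matIntegral, Matrix.mul_apply, Matrix.of_apply, ← integral_mul_const]
  exact (integral_finsetSum _ fun k _ => integrable_of_continuous
    ((hF.matrix_elem i k).mul continuous_const)).symm

theorem trace_matIntegral {m : Type*} [Fintype m] {F : G → Matrix m m ℂ} (hF : Continuous F) :
    (matIntegral F).trace = ∫ x, (F x).trace ∂(haarProb G) := by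
  simp only [matIntegral, Matrix.trace, Matrix.diag_apply, Matrix.of_apply]
  exact (integral_finsetSum _ fun k _ => integrable_of_continuous (hF.matrix_elem k k)).symm

theorem matIntegral_comp_mul_left {m n : Type*} (F : G → Matrix m n ℂ) (g : G) :
    (matIntegral fun x => F (g * x)) = matIntegral F := by
  ext i j
  exact integral_mul_left_eq_self (fun x => F x i j) g

/-- Averaging over the group produces intertwiners: substitute x ↦ g x and use left invariance of
Haar measure. -/
theorem matIntegral_intertwines (ξ η : UnitaryDual G) (M : Matrix (Fin ξ.dim) (Fin η.dim) ℂ)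
    (g : G) : ξ.mat g * (matIntegral fun x => ξ.mat x * M * (η.mat x)ᴴ) =
      (matIntegral fun x => ξ.mat x * M * (η.mat x)ᴴ) * η.mat g := by
  have hc := continuous_conjugation ξ η M
  rw [mul_matIntegral hc, matIntegral_mul hc]
  refine Eq.trans (congrArg _ ?_)
    (matIntegral_comp_mul_left (fun x => ξ.mat x * M * (η.mat x)ᴴ * η.mat g) g)
  funext x
  rw [ξ.mat_mul, η.mat_mul, conjTranspose_mul]
  simp only [Matrix.mul_assoc]
  rw [η.conjTranspose_mul_mat, Matrix.mul_one]

theorem integral_conjugation_of_ne {ξ η : UnitaryDual G} (h : ξ ≠ η)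
    (M : Matrix (Fin ξ.dim) (Fin η.dim) ℂ) :
    (matIntegral fun x => ξ.mat x * M * (η.mat x)ᴴ) = 0 := by
  by_contra h0
  exact h (UnitaryDual.eq_of_intertwiner _ (matIntegral_intertwines ξ η M) h0)

/-- By Schur's lemma the average is scalar; conjugation preserves the trace, which determines the
scalar. -/
theorem integral_conjugation (ξ : UnitaryDual G) (M : Matrix (Fin ξ.dim) (Fin ξ.dim) ℂ) :
    (matIntegral fun x => ξ.mat x * M * (ξ.mat x)ᴴ) = (M.trace / ξ.dim) • 1 := by
  obtain ⟨c, hc⟩ := ξ.exists_eq_smul_one _ (matIntegral_intertwines ξ ξ M)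
  have h1 := trace_matIntegral (continuous_conjugation ξ ξ M)
  have h2 : ∀ x, (ξ.mat x * M * (ξ.mat x)ᴴ).trace = M.trace := fun x => by
    rw [Matrix.trace_mul_comm, ← Matrix.mul_assoc, ξ.conjTranspose_mul_mat, Matrix.one_mul]
  simp only [h2, integral_const, probReal_univ, one_smul] at h1
  rw [hc, Matrix.trace_smul, Matrix.trace_one, Fintype.card_fin, smul_eq_mul] at h1
  rw [hc, ← h1, mul_div_cancel_right₀ _ ξ.dim_ne_zero]

/-- Taking a matrix unit for M in the averaged conjugation, a single entry of the average is the
inner product of two matrix coefficients. -/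
theorem inner_coef_of_ne {ξ η : UnitaryDual G} (h : ξ ≠ η) (i j : Fin ξ.dim) (k l : Fin η.dim) :
    inner ℂ (toL2 (η.coef k l)) (toL2 (ξ.coef i j)) = 0 := by
  have := congrFun (congrFun (integral_conjugation_of_ne h (Matrix.single j l 1)) i) k
  rw [inner_toL2]
  simpa [matIntegral, Matrix.mul_assoc, Matrix.mul_apply, Matrix.single_apply, ite_and,
    UnitaryDual.coef] using this

theorem inner_coef (ξ : UnitaryDual G) (i j k l : Fin ξ.dim) :
    inner ℂ (toL2 (ξ.coef k l)) (toL2 (ξ.coef i j)) =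
      if k = i ∧ l = j then (ξ.dim : ℂ)⁻¹ else 0 := by
  have := congrFun (congrFun (integral_conjugation ξ (Matrix.single j l 1)) i) k
  rw [inner_toL2]
  have h2 : (Matrix.single j l (1 : ℂ)).trace = if l = j then 1 else 0 := by
    by_cases h : l = j
    · subst h; simp
    · simp [h, Matrix.trace_single_eq_of_ne _ _ _ (Ne.symm h)]
  rw [h2] at this
  have h3 : ∀ x, (ξ.mat x * Matrix.single j l (1 : ℂ) * (ξ.mat x)ᴴ) i k =
      ξ.coef i j x * conj (ξ.coef k l x) := fun x => by
    simp [Matrix.mul_apply, Matrix.single_apply, ite_and, UnitaryDual.coef]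
  simp only [matIntegral, Matrix.of_apply, h3] at this
  rw [this]
  rcases eq_or_ne k i with rfl | h1
  · by_cases h2 : l = j <;> simp [h2]
  · simp [h1, Matrix.one_apply_ne h1.symm]

/-- The normalized matrix coefficients `√d_ξ ξ_{ij}` in `L²(G)`. -/
def coefL2 (p : Σ ξ : UnitaryDual G, Fin ξ.dim × Fin ξ.dim) : Lp ℂ 2 (haarProb G) :=
  ((Real.sqrt p.1.dim : ℝ) : ℂ) • toL2 (p.1.coef p.2.1 p.2.2)

theorem orthonormal_coefL2 : Orthonormal ℂ (coefL2 (G := G)) := by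
  classical
  rw [orthonormal_iff_ite]
  rintro ⟨η, k, l⟩ ⟨ξ, i, j⟩
  simp only [coefL2, inner_smul_left, inner_smul_right, Complex.conj_ofReal]
  by_cases h : ξ = η
  · subst h
    rw [inner_coef, ← mul_assoc, sqrt_dim_mul_self]
    by_cases h1 : k = i <;> by_cases h2 : l = j <;> simp [h1, h2, ξ.dim_ne_zero]
  · rw [inner_coef_of_ne h, mul_zero, mul_zero, if_neg]
    rintro h1
    exact h (congrArg Sigma.fst h1).symm

variable [T2Space G]

variable (G) in
/-- The Hilbert basis of normalized matrix coefficients of `L²(G)`. -/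
def coefBasis : HilbertBasis (Σ ξ : UnitaryDual G, Fin ξ.dim × Fin ξ.dim) ℂ
    (Lp ℂ 2 (haarProb G)) :=
  HilbertBasis.mkOfOrthogonalEqBot orthonormal_coefL2 (by
    refine eq_bot_iff.2 (le_trans (Submodule.orthogonal_le ?_) trigPoly_orthogonal.le)
    rw [trigPoly, Submodule.map_span_le]
    rintro _ ⟨p, rfl⟩
    have h : toL2 (p.1.coef p.2.1 p.2.2) =
        (((Real.sqrt p.1.dim : ℝ) : ℂ))⁻¹ • coefL2 p := by
      rw [coefL2, smul_smul, inv_mul_cancel₀, one_smul]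
      intro h0
      have := sqrt_dim_mul_self p.1
      rw [h0, zero_mul] at this
      exact p.1.dim_ne_zero this.symm
    change toL2 (p.1.coef p.2.1 p.2.2) ∈ _
    rw [h]
    exact Submodule.smul_mem _ _ (Submodule.subset_span ⟨p, rfl⟩))

omit [T2Space G] in
theorem fourierCoeff_apply (u : C(G, ℂ)) (ξ : UnitaryDual G) (i j : Fin ξ.dim) :
    fourierCoeff u ξ i j = inner ℂ (toL2 (ξ.coef j i)) (toL2 u) := by
  rw [inner_toL2]
  rfl

/-- The Plancherel theorem on a compact group. -/
theorem hasSum_plancherel (u v : C(G, ℂ)) :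
    HasSum (fun ξ : UnitaryDual G => (ξ.dim : ℂ) *
      (fourierCoeff u ξ * (fourierCoeff v ξ)ᴴ).trace) (∫ x, u x * conj (v x) ∂(haarProb G)) := by
  have h := (coefBasis G).hasSum_inner_mul_inner (toL2 v) (toL2 u)
  rw [inner_toL2] at h
  -- Parseval is grouped into the finite block of each ξ; the factor d_ξ comes from the
  -- normalization √d_ξ of the basis vectors.
  refine h.sigma fun ξ => ?_
  have h2 : (ξ.dim : ℂ) * (fourierCoeff u ξ * (fourierCoeff v ξ)ᴴ).trace =
      ∑ p : Fin ξ.dim × Fin ξ.dim, inner ℂ (toL2 v) ((coefBasis G) ⟨ξ, p⟩) *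
        inner ℂ ((coefBasis G) ⟨ξ, p⟩) (toL2 u) := by
    simp only [Matrix.trace, Matrix.diag_apply, Matrix.mul_apply, conjTranspose_apply,
      fourierCoeff_apply, Fintype.sum_prod_type, Finset.mul_sum]
    rw [Finset.sum_comm]
    refine Finset.sum_congr rfl fun i _ => Finset.sum_congr rfl fun j _ => ?_
    simp only [coefBasis, HilbertBasis.coe_mkOfOrthogonalEqBot, coefL2, inner_smul_left,
      inner_smul_right, Complex.conj_ofReal]
    rw [← sqrt_dim_mul_self, ← starRingEnd_apply, inner_conj_symm]
    ring
  rw [h2]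
  exact hasSum_fintype _

theorem eq_zero_of_fourierCoeff_eq_zero {u : G → ℂ} (hu : Continuous u)
    (h : ∀ ξ, fourierCoeff u ξ = 0) : u = 0 := by
  let f : C(G, ℂ) := ⟨u, hu⟩
  have h1 := hasSum_plancherel f f
  have h2 : ∀ ξ, fourierCoeff f ξ = 0 := h
  simp only [h2, Matrix.zero_mul, Matrix.trace_zero, mul_zero] at h1
  rw [← inner_toL2] at h1
  have h3 := inner_self_eq_zero.1 (h1.unique hasSum_zero)
  have h4 := toL2_injective (h3.trans (map_zero _).symm)
  exact congrArg DFunLike.coe h4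

theorem fourierCoeff_injective {u v : G → ℂ} (hu : Continuous u) (hv : Continuous v)
    (h : ∀ ξ, fourierCoeff u ξ = fourierCoeff v ξ) : u = v := by
  rw [← sub_eq_zero]
  refine eq_zero_of_fourierCoeff_eq_zero (hu.sub hv) fun ξ => ?_
  ext i j
  have h1 := congrFun (congrFun (h ξ) i) j
  have h2 := fourierCoeff_apply (⟨u, hu⟩ - ⟨v, hv⟩ : C(G, ℂ)) ξ i j
  rw [map_sub, inner_sub_right, ← fourierCoeff_apply, ← fourierCoeff_apply] at h2
  exact h2.trans (sub_eq_zero.2 h1)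

/-- Injectivity makes `fourierLagInv`, defined through a choice of preimage, a genuine inverse on
test functions. -/
theorem injOn_fourierLag :
    Set.InjOn fourierLag (SchwartzBruhat (G × G) : Set (G × G → ℂ)) := by
  intro w hw w' hw' h
  have hc := IsSchwartz.continuous hw
  have hc' := IsSchwartz.continuous hw'
  funext p
  exact congrFun (fourierCoeff_injective (u := fun y => w (p.1, y)) (v := fun y => w' (p.1, y))
    (by fun_prop) (by fun_prop) fun ξ => congrFun (congrFun h p.1) ξ) p.2

theorem injOn_fourierTime :
    Set.InjOn fourierTime (SchwartzBruhat (G × G) : Set (G × G → ℂ)) := by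
  intro w hw w' hw' h
  have hc := IsSchwartz.continuous hw
  have hc' := IsSchwartz.continuous hw'
  funext p
  exact congrFun (fourierCoeff_injective (u := fun x => w (x, p.2)) (v := fun x => w' (x, p.2))
    (by fun_prop) (by fun_prop) fun ξ => congrFun (congrFun h ξ) p.2) p.1

theorem fourierLagInv_fourierLag {w : G × G → ℂ} (hw : IsSchwartz w) :
    fourierLagInv (fourierLag w) = w :=
  injOn_fourierLag.leftInvOn_invFunOn hw

theorem fourierTimeInv_fourierTime {w : G × G → ℂ} (hw : IsSchwartz w) :
    fourierTimeInv (fourierTime w) = w :=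
  injOn_fourierTime.leftInvOn_invFunOn hw

theorem sympFourier_fourierLag {w : G × G → ℂ} (hw : IsSchwartz w) :
    sympFourier (fourierLag w) = fourierTime w := by
  rw [sympFourier, fourierLagInv_fourierLag hw]

theorem sympFourierInv_fourierTime {w : G × G → ℂ} (hw : IsSchwartz w) :
    sympFourierInv (fourierTime w) = fourierLag w := by
  rw [sympFourierInv, fourierTimeInv_fourierTime hw]

end Schur

/-! ### Isotypic functions and ambiguity kernels -/

section Isotypic

variable {G : Type u} [Group G] [TopologicalSpace G]

namespace SchwartzDistribution

theorem eval_eq (T : SchwartzDistribution G) {h : G → ℂ} (hh : IsSchwartz h) :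
    T.eval h = T.toLinearMap ⟨h, hh⟩ :=
  dif_pos hh

theorem eval_const_mul (T : SchwartzDistribution G) {h : G → ℂ} (hh : IsSchwartz h) (c : ℂ) :
    T.eval (fun x => c * h x) = c * T.eval h := by
  rw [T.eval_eq ((IsSchwartz.const c).mul hh), T.eval_eq hh, ← smul_eq_mul, ← map_smul]
  rfl

theorem eval_dirac {h : G → ℂ} (hh : IsSchwartz h) (y : G) : (dirac y).eval h = h y :=
  eval_eq _ hh

theorem pairing_dirac {h : G → ℂ} (hh : IsSchwartz h) (y : G) : pairing h (dirac y) = h y := by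
  rw [pairing, eval_dirac hh.conj, Complex.conj_conj]

end SchwartzDistribution

/-- The function `(x, y) ↦ d_ξ tr(ξ(x) c(y))`. -/
def isotypic (ξ : UnitaryDual G) (c : G → Matrix (Fin ξ.dim) (Fin ξ.dim) ℂ) : G × G → ℂ :=
  fun p => ξ.dim * (ξ.mat p.1 * c p.2).trace

theorem isotypic_eq_sum (ξ : UnitaryDual G) (c : G → Matrix (Fin ξ.dim) (Fin ξ.dim) ℂ)
    (p : G × G) :
    isotypic ξ c p = ∑ i, ∑ j, ξ.dim * c p.2 j i * ξ.mat p.1 i j := by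
  simp only [isotypic, Matrix.trace, Matrix.diag_apply, Matrix.mul_apply, Finset.mul_sum]
  refine Finset.sum_congr rfl fun i _ => Finset.sum_congr rfl fun j _ => ?_
  ring

theorem isSchwartz_isotypic (ξ : UnitaryDual G) {c : G → Matrix (Fin ξ.dim) (Fin ξ.dim) ℂ}
    (hc : ∀ i j, IsSchwartz fun y => c y i j) : IsSchwartz (isotypic ξ c) := by
  rw [funext (isotypic_eq_sum ξ c)]
  exact IsSchwartz.sum _ fun i _ => IsSchwartz.sum _ fun j _ =>
    ((IsSchwartz.const _).mul ((hc j i).comp_hom (ContinuousMonoidHom.snd G G))).mul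
      ((ξ.isSchwartz_mat i j).comp_hom (ContinuousMonoidHom.fst G G))

theorem continuous_isotypic (ξ : UnitaryDual G) {c : G → Matrix (Fin ξ.dim) (Fin ξ.dim) ℂ}
    (hc : Continuous c) : Continuous (isotypic ξ c) :=
  continuous_const.mul (((ξ.continuous_mat.comp continuous_fst).matrix_mul
    (hc.comp continuous_snd)).matrix_trace)

/-- The test function `x ↦ d_ξ tr(ξ(x) m)`. -/
def isotypicTest (ξ : UnitaryDual G) (m : Matrix (Fin ξ.dim) (Fin ξ.dim) ℂ) : SchwartzBruhat G :=
  ⟨fun x => isotypic ξ (fun _ => m) (x, 1), by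
    simp only [isotypic_eq_sum]
    exact IsSchwartz.sum _ fun i _ => IsSchwartz.sum _ fun j _ =>
      (IsSchwartz.const _).mul (ξ.isSchwartz_mat i j)⟩

variable [IsTopologicalGroup G] [CompactSpace G] [MeasurableSpace G] [BorelSpace G]

theorem toL2_isotypic (ξ : UnitaryDual G) (m : Matrix (Fin ξ.dim) (Fin ξ.dim) ℂ) (f : C(G, ℂ))
    (hf : ∀ x, f x = isotypic ξ (fun _ => m) (x, 1)) :
    toL2 f = ∑ i, ∑ j, (ξ.dim * m j i : ℂ) • toL2 (ξ.coef i j) := by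
  have : f = ∑ i, ∑ j, (ξ.dim * m j i : ℂ) • ξ.coef i j := by
    ext x
    rw [hf, isotypic_eq_sum]
    simp only [ContinuousMap.coe_sum, Finset.sum_apply, ContinuousMap.coe_smul, Pi.smul_apply,
      smul_eq_mul]
    rfl
  rw [this]
  simp only [map_sum, map_smul]

/-- Fourier inversion for a field supported at one class: the factor d_ξ in `isotypic` cancels the
d_ξ⁻¹ of Schur orthogonality. -/
theorem fourierTime_isotypic (ξ : UnitaryDual G) (c : G → Matrix (Fin ξ.dim) (Fin ξ.dim) ℂ)
    (y : G) : fourierTime (isotypic ξ c) ξ y = c y := by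
  ext k l
  let f : C(G, ℂ) := ⟨fun x => isotypic ξ (fun _ => c y) (x, 1), continuous_const.mul
    ((ξ.continuous_mat.matrix_mul continuous_const).matrix_trace)⟩
  have h := toL2_isotypic ξ (c y) f fun _ => rfl
  change fourierCoeff f ξ k l = _
  rw [fourierCoeff_apply, h]
  simp only [inner_sum, inner_smul_right, inner_coef, ite_and]
  simp only [Finset.sum_ite_irrel, Finset.sum_const_zero, mul_ite, mul_zero, Finset.sum_ite_eq,
    Finset.mem_univ, if_true]
  rw [mul_right_comm, mul_inv_cancel₀ ξ.dim_ne_zero, one_mul]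

theorem fourierTime_isotypic_of_ne {ξ η : UnitaryDual G} (h : η ≠ ξ)
    (c : G → Matrix (Fin ξ.dim) (Fin ξ.dim) ℂ) (y : G) :
    fourierTime (isotypic ξ c) η y = 0 := by
  ext k l
  let f : C(G, ℂ) := ⟨fun x => isotypic ξ (fun _ => c y) (x, 1), continuous_const.mul
    ((ξ.continuous_mat.matrix_mul continuous_const).matrix_trace)⟩
  have h1 := toL2_isotypic ξ (c y) f fun _ => rfl
  change fourierCoeff f η k l = _
  rw [fourierCoeff_apply, h1]
  simp [inner_sum, inner_smul_right, inner_coef_of_ne h.symm]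

/-- This is the advantage of testing with v = 𝟏: the lag product no longer depends on y, so the
kernel is multiplied by a constant matrix. -/
theorem fourierTime_lagProduct_one (u : SchwartzBruhat G) (ξ : UnitaryDual G) (y : G) :
    fourierTime (lagProduct (u : G → ℂ) (SchwartzBruhat.one : SchwartzBruhat G)) ξ y =
      fourierCoeff (u : G → ℂ) ξ := by
  simp [fourierTime, lagProduct, SchwartzBruhat.one]

theorem fourierCoeff_isotypicTest (ξ : UnitaryDual G) (m : Matrix (Fin ξ.dim) (Fin ξ.dim) ℂ) :
    fourierCoeff (isotypicTest ξ m : G → ℂ) ξ = m :=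
  fourierTime_isotypic ξ (fun _ => m) 1

theorem fourierCoeff_isotypicTest_of_ne {ξ η : UnitaryDual G} (h : η ≠ ξ)
    (m : Matrix (Fin ξ.dim) (Fin ξ.dim) ℂ) :
    fourierCoeff (isotypicTest ξ m : G → ℂ) η = 0 :=
  fourierTime_isotypic_of_ne h (fun _ => m) 1

variable [T2Space G]

theorem sympFourier_rihaczek (u v : SchwartzBruhat G) :
    sympFourier (rihaczek (u : G → ℂ) (v : G → ℂ)) = fourierTime (lagProduct (u : G → ℂ) v) := by
  rw [← fourierLag_lagProduct, sympFourier_fourierLag (lagProduct_mem u v)]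

namespace TFTransform

variable (D : TFTransform G)

/-- This removes the chosen inverse transforms: later arguments use only the test function `w` and
the action of the kernel on its first-variable Fourier coefficients. -/
theorem exists_lag (u v : SchwartzBruhat G) : ∃ w : G × G → ℂ, IsSchwartz w ∧
    D.transform u v = fourierLag w ∧
    ∀ ξ y, fourierTime w ξ y = D.kernel ξ y * fourierTime (lagProduct (u : G → ℂ) v) ξ y := by
  obtain ⟨w, hw, h⟩ := D.mapsTo' u v
  refine ⟨w, hw, ?_, fun ξ y => ?_⟩
  · rw [transform, ← h, sympFourierInv_fourierTime hw]
  · rw [← sympFourier_rihaczek]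
    exact congrFun (congrFun h ξ) y

/-- With u(x) = d_ξ tr ξ(x) and v = 𝟏 the ambiguity function of D(u, v) at ξ is the kernel itself.
It is thus a Fourier coefficient in x of a test function on G × G. -/
theorem isSchwartz_kernel (ξ : UnitaryDual G) (i j : Fin ξ.dim) :
    IsSchwartz fun y => D.kernel ξ y i j := by
  obtain ⟨w, hw, -, h⟩ := D.exists_lag (isotypicTest ξ 1) SchwartzBruhat.one
  have h1 : (fun y => D.kernel ξ y i j) =
      fun y => ∫ x, w (x, y) * (ξ.mat x)ᴴ i j ∂(haarProb G) := by
    funext y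
    have := congrFun (congrFun (h ξ y) i) j
    rw [fourierTime_lagProduct_one, fourierCoeff_isotypicTest, Matrix.mul_one] at this
    exact this.symm
  rw [h1]
  exact hw.integral_fst (ξ.continuous_mat.matrix_conjTranspose.matrix_elem i j)

theorem isSchwartz_conjTranspose_kernel_mul (ξ : UnitaryDual G)
    {c : G → Matrix (Fin ξ.dim) (Fin ξ.dim) ℂ} (hc : ∀ i j, IsSchwartz fun y => c y i j)
    (i j : Fin ξ.dim) : IsSchwartz fun y => ((D.kernel ξ y)ᴴ * c y) i j := by
  simp only [Matrix.mul_apply, conjTranspose_apply]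
  exact IsSchwartz.sum _ fun k _ => (D.isSchwartz_kernel ξ k i).conj.mul (hc k j)

/-- By duality a second factor φ_D^* is applied, giving a field supported at ξ alone. Pairing with
R(δ_e, δ_y) then evaluates its inverse Fourier transform at (e, y⁻¹). -/
theorem distribution_transform_isotypicTest (ξ : UnitaryDual G)
    (m : Matrix (Fin ξ.dim) (Fin ξ.dim) ℂ) (y : G) :
    D.distribution (dirac 1) (dirac y) (D.transform (isotypicTest ξ m) SchwartzBruhat.one) =
      ξ.dim * ((D.kernel ξ y⁻¹)ᴴ * (D.kernel ξ y⁻¹ * m)).trace := by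
  obtain ⟨w, hw, h1, h2⟩ := D.exists_lag (isotypicTest ξ m) SchwartzBruhat.one
  set c : G → Matrix (Fin ξ.dim) (Fin ξ.dim) ℂ := fun y =>
    (D.kernel ξ y)ᴴ * (D.kernel ξ y * m) with hc
  have hcs : ∀ i j, IsSchwartz fun y => c y i j :=
    D.isSchwartz_conjTranspose_kernel_mul ξ fun i j => by
      simp only [Matrix.mul_apply]
      exact IsSchwartz.sum _ fun k _ => (D.isSchwartz_kernel ξ i k).mul (IsSchwartz.const _)
  have hs := isSchwartz_isotypic ξ hcs
  have h3 : (fun η z => (D.kernel η z)ᴴ * sympFourier (fourierLag w) η z) =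
      fourierTime (isotypic ξ c) := by
    funext η z
    rw [sympFourier_fourierLag hw, h2, fourierTime_lagProduct_one]
    by_cases h : η = ξ
    · subst h
      rw [fourierCoeff_isotypicTest, fourierTime_isotypic]
    · rw [fourierCoeff_isotypicTest_of_ne h, fourierTime_isotypic_of_ne h, Matrix.mul_zero,
        Matrix.mul_zero]
  rw [distribution, h1, h3, sympFourierInv_fourierTime hs, rihaczekDistribution,
    fourierLagInv_fourierLag hs]
  -- `eval` is 0 off the test functions, so both slices must be shown to be test functions before
  -- the deltas evaluate them.
  have h4 : ∀ x, IsSchwartz fun z => isotypic ξ c (x, z⁻¹ * x) := fun x => by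
    simp only [isotypic_eq_sum]
    exact IsSchwartz.sum _ fun i _ => IsSchwartz.sum _ fun j _ =>
      ((IsSchwartz.const _).mul (((hcs j i).comp_mul_right x).comp_inv)).mul (IsSchwartz.const _)
  have h5 : IsSchwartz fun x => isotypic ξ c (x, y⁻¹ * x) := by
    simp only [isotypic_eq_sum]
    exact IsSchwartz.sum _ fun i _ => IsSchwartz.sum _ fun j _ =>
      ((IsSchwartz.const _).mul ((hcs j i).comp_mul_left y⁻¹)).mul (ξ.isSchwartz_mat i j)
  have h6 : (fun x => (dirac y).eval fun z => isotypic ξ c (x, z⁻¹ * x)) =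
      fun x => isotypic ξ c (x, y⁻¹ * x) := by
    funext x
    exact SchwartzDistribution.eval_dirac (h4 x) y
  rw [h6, SchwartzDistribution.pairing_dirac h5, isotypic, mul_one, ξ.mat_one, Matrix.one_mul]

/-- A kernel satisfying the Moyal identity against delta distributions is unitary. -/
theorem kernel_mem_unitaryGroup
    (h : ∀ (u : SchwartzBruhat G) (y : G),
      D.distribution (dirac 1) (dirac y) (D.transform u SchwartzBruhat.one) = (u : G → ℂ) 1)
    (ξ : UnitaryDual G) (y : G) : D.kernel ξ y ∈ Matrix.unitaryGroup (Fin ξ.dim) ℂ := by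
  rw [Matrix.mem_unitaryGroup_iff', Matrix.star_eq_conjTranspose]
  refine Matrix.ext_iff_trace_mul_right.2 fun m => ?_
  -- The inverse compensates for the evaluation at y⁻¹, and m ranges over all matrices, so the trace
  -- pairing recovers φ_D^* φ_D = I.
  have h1 := h (isotypicTest ξ m) y⁻¹
  rw [distribution_transform_isotypicTest, inv_inv, ← Matrix.mul_assoc] at h1
  refine mul_left_cancel₀ ξ.dim_ne_zero (h1.trans ?_)
  change (ξ.dim : ℂ) * (ξ.mat 1 * m).trace = _
  rw [ξ.mat_one]

/-- A time-frequency transform with unitary kernel satisfies the Moyal identity. -/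
theorem isUnitary_of_kernel
    (h : ∀ ξ y, D.kernel ξ y ∈ Matrix.unitaryGroup (Fin ξ.dim) ℂ) : D.IsUnitary := by
  intro u v f g
  obtain ⟨w, hw, h1, h2⟩ := D.exists_lag u v
  -- Here φ_D^* φ_D = I leaves exactly the ambiguity function of R(u, v).
  have h3 : (fun ξ y => (D.kernel ξ y)ᴴ * sympFourier (fourierLag w) ξ y) =
      fourierTime (lagProduct (u : G → ℂ) v) := by
    funext ξ y
    have h4 := Matrix.mem_unitaryGroup_iff'.1 (h ξ y)
    rw [Matrix.star_eq_conjTranspose] at h4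
    rw [sympFourier_fourierLag hw, h2, ← Matrix.mul_assoc, h4, Matrix.one_mul]
  have hs := lagProduct_mem u v
  rw [distribution, h1, h3, sympFourierInv_fourierTime hs, rihaczekDistribution,
    fourierLagInv_fourierLag hs]
  have hu : IsSchwartz (u : G → ℂ) := u.2
  have hv : IsSchwartz (v : G → ℂ) := v.2
  -- At y = z⁻¹ x the argument x y⁻¹ equals z, so the variables separate and the distributions act
  -- independently.
  have h5 : (fun x => g.eval fun z => lagProduct (u : G → ℂ) v (x, z⁻¹ * x)) =
      fun x => (g.eval fun z => conj ((v : G → ℂ) z)) * (u : G → ℂ) x := by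
    funext x
    rw [mul_comm, ← g.eval_const_mul hv.conj]
    congr 1
    funext z
    simp [lagProduct]
  rw [h5, SchwartzDistribution.pairing]
  simp only [map_mul]
  rw [f.eval_const_mul hu.conj, map_mul, SchwartzDistribution.pairing,
    SchwartzDistribution.pairing]
  simp only [Complex.conj_conj]
  rw [mul_comm]

omit [T2Space G] in
theorem distribution_dirac_of_isUnitary (h : D.IsUnitary) (u : SchwartzBruhat G) (y : G) :
    D.distribution (dirac 1) (dirac y) (D.transform u SchwartzBruhat.one) = (u : G → ℂ) 1 := by
  rw [h, SchwartzDistribution.pairing_dirac u.2,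
    SchwartzDistribution.pairing_dirac SchwartzBruhat.one.2]
  simp [SchwartzBruhat.one]

end TFTransform

theorem kohnNirenberg_transform (u v : SchwartzBruhat G) :
    (kohnNirenberg G).transform u v = rihaczek (u : G → ℂ) (v : G → ℂ) := by
  have h : (fun ξ y => (kohnNirenberg G).kernel ξ y *
      sympFourier (rihaczek (u : G → ℂ) (v : G → ℂ)) ξ y) =
        fourierTime (lagProduct (u : G → ℂ) v) := by
    rw [← sympFourier_rihaczek]
    funext ξ y
    exact Matrix.one_mul _
  rw [TFTransform.transform, h, sympFourierInv_fourierTime (lagProduct_mem u v),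
    fourierLag_lagProduct]

theorem kohnNirenberg_isUnitary : (kohnNirenberg G).IsUnitary :=
  (kohnNirenberg G).isUnitary_of_kernel fun ξ _ => (Matrix.unitaryGroup (Fin ξ.dim) ℂ).one_mem

end Isotypic

/-! ### Kernels of quantized symbols -/

section Quantization

variable {G : Type u} [Group G] [TopologicalSpace G] [IsTopologicalGroup G] [CompactSpace G]
  [MeasurableSpace G] [BorelSpace G]

theorem continuous_fourierTime (w : C(G × G, ℂ)) (ξ : UnitaryDual G) :
    Continuous (fourierTime w ξ) := by
  refine continuous_matrix fun i j => ?_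
  let F : C(G × G, ℂ) := w.comp ⟨Prod.swap, continuous_swap⟩
  have h : (fun y => fourierTime w ξ y i j) =
      fun y => inner ℂ (toL2 (ξ.coef j i)) (toL2 (F.curry y)) :=
    funext fun y => fourierCoeff_apply (F.curry y) ξ i j
  rw [h]
  exact continuous_const.inner (toL2.continuous.comp F.curry.continuous)

/-- The change of variables `w(x, y) ↦ w(x, z⁻¹ x)`. -/
def shear (w : C(G × G, ℂ)) : C(G × G, ℂ) := ⟨fun p => w (p.1, p.2⁻¹ * p.1), by fun_prop⟩

variable [T2Space G]

/-- The square-integrable kernel `w(x, z⁻¹ x)`. -/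
def lagKernel (w : C(G × G, ℂ)) : KernelSpace (haarProb G) := contKernel (haarProb G) (shear w)

/-- For fixed x the substitution z = x y⁻¹ preserves Haar measure, so the shear is isometric. -/
theorem inner_lagKernel (w w' : C(G × G, ℂ)) :
    inner ℂ (lagKernel w) (lagKernel w') =
      ∫ x, ∫ y, w' (x, y) * conj (w (x, y)) ∂(haarProb G) ∂(haarProb G) := by
  rw [lagKernel, lagKernel, inner_kernel]
  refine integral_congr_ae (Filter.Eventually.of_forall fun x => ?_)
  have h := integral_div_left_eq_self (fun z => shear w' (x, z) * conj (shear w (x, z)))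
    (haarProb G) x
  refine h.symm.trans (integral_congr_ae (Filter.Eventually.of_forall fun y => ?_))
  simp [shear]

theorem inner_lagKernel_eq_inner_kernel (w w' : C(G × G, ℂ)) :
    inner ℂ (lagKernel w) (lagKernel w') =
      inner ℂ (contKernel (haarProb G) w) (contKernel (haarProb G) w') := by
  rw [inner_lagKernel, inner_kernel]

/-- The adjoint integrates the conjugate kernel in its first variable, and against a matrix
coefficient this is a conjugated Fourier coefficient. The Hilbert–Schmidt trace in `coefBasis`
thereby becomes a Plancherel formula. -/
theorem inner_adjoint_op_kernel (w : C(G × G, ℂ)) (ξ : UnitaryDual G) (i j : Fin ξ.dim) :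
    ContinuousLinearMap.adjoint (isHilbertTensor_tensor.op (contKernel (haarProb G) w))
      (toL2 (ξ.coef i j)) = toL2 ⟨fun y => conj (fourierTime w ξ y j i),
        Complex.continuous_conj.comp ((continuous_fourierTime w ξ).matrix_elem j i)⟩ := by
  have hd := ContinuousMap.toLp_denseRange (E := ℂ) (haarProb G) ℂ (p := 2) (by simp)
  refine hd.eq_of_inner_left (𝕜 := ℂ) fun g => ?_
  rw [ContinuousLinearMap.adjoint_inner_left, ← inner_conj_symm, inner_op_kernel_toLp, inner_toL2,
    ← integral_conj]
  simp only [← integral_conj]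
  have hc := Complex.continuous_conj
  rw [integral_integral_swap_of_hasCompactSupport (by
    simp only [Function.uncurry_def]; fun_prop) (HasCompactSupport.of_compactSpace _)]
  refine integral_congr_ae (Filter.Eventually.of_forall fun y => ?_)
  simp only [ContinuousMap.coe_mk, Complex.conj_conj, fourierTime, fourierCoeff, Matrix.of_apply]
  rw [← integral_const_mul]
  refine integral_congr_ae (Filter.Eventually.of_forall fun x => ?_)
  simp only [map_mul, Complex.conj_conj, conjTranspose_apply, UnitaryDual.coef,
    ContinuousMap.coe_mk]
  rw [← starRingEnd_apply]
  ring

/-- The Plancherel theorem in the first variable. -/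
theorem hasSum_inner_lagKernel (w w' : C(G × G, ℂ)) :
    HasSum (fun ξ : UnitaryDual G => ∫ y, (ξ.dim : ℂ) *
      (fourierTime w' ξ y * (fourierTime w ξ y)ᴴ).trace ∂(haarProb G))
      (inner ℂ (lagKernel w) (lagKernel w')) := by
  -- Evaluating the trace in the basis of matrix coefficients yields the sum of integrals directly,
  -- without interchanging sum and integral.
  have h := isHilbertTensor_tensor.hasTrace
    (fun u v => isHilbertTensor_tensor.inner_op (contKernel (haarProb G) w') u v)
    (fun u v => isHilbertTensor_tensor.inner_op (contKernel (haarProb G) w) u v) _ (coefBasis G)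
  rw [inner_lagKernel_eq_inner_kernel]
  refine h.sigma fun ξ => ?_
  have h2 : ∀ p : Fin ξ.dim × Fin ξ.dim,
      inner ℂ ((coefBasis G) ⟨ξ, p⟩) ((isHilbertTensor_tensor.op (contKernel (haarProb G) w') ∘L
        ContinuousLinearMap.adjoint (isHilbertTensor_tensor.op (contKernel (haarProb G) w)))
        ((coefBasis G) ⟨ξ, p⟩)) =
      ∫ y, ξ.dim * (fourierTime w' ξ y p.2 p.1 * conj (fourierTime w ξ y p.2 p.1))
        ∂(haarProb G) := by
    intro p
    rw [ContinuousLinearMap.comp_apply, ← ContinuousLinearMap.adjoint_inner_left]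
    simp only [coefBasis, HilbertBasis.coe_mkOfOrthogonalEqBot, coefL2, map_smul,
      inner_smul_left, inner_smul_right, Complex.conj_ofReal]
    rw [← mul_assoc, sqrt_dim_mul_self, inner_adjoint_op_kernel, inner_adjoint_op_kernel,
      inner_toL2, ← integral_const_mul]
    refine integral_congr_ae (Filter.Eventually.of_forall fun y => ?_)
    simp only [ContinuousMap.coe_mk, Complex.conj_conj]
    ring
  have h3 : ∫ y, (ξ.dim : ℂ) * (fourierTime w' ξ y * (fourierTime w ξ y)ᴴ).trace ∂(haarProb G) =
      ∑ p : Fin ξ.dim × Fin ξ.dim,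
        ∫ y, ξ.dim * (fourierTime w' ξ y p.2 p.1 * conj (fourierTime w ξ y p.2 p.1))
          ∂(haarProb G) := by
    have hc := Complex.continuous_conj
    rw [← integral_finsetSum _ fun p _ => integrable_of_continuous (by
      have h4 := (continuous_fourierTime w ξ).matrix_elem p.2 p.1
      have h5 := (continuous_fourierTime w' ξ).matrix_elem p.2 p.1
      fun_prop)]
    refine integral_congr_ae (Filter.Eventually.of_forall fun y => ?_)
    simp only [Matrix.trace, Matrix.diag_apply, Matrix.mul_apply, conjTranspose_apply,
      Fintype.sum_prod_type, Finset.mul_sum]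
    rw [Finset.sum_comm]
    rfl
  rw [h3]
  simp only [← h2]
  exact hasSum_fintype _

/-- Continuous isotypic functions. -/
def isotypicC (ξ : UnitaryDual G) (c : C(G, Matrix (Fin ξ.dim) (Fin ξ.dim) ℂ)) : C(G × G, ℂ) :=
  ⟨isotypic ξ c, continuous_isotypic ξ c.continuous⟩

theorem inner_lagKernel_isotypicC (w : C(G × G, ℂ)) (ξ : UnitaryDual G)
    (c : C(G, Matrix (Fin ξ.dim) (Fin ξ.dim) ℂ)) :
    inner ℂ (lagKernel w) (lagKernel (isotypicC ξ c)) =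
      ∫ y, (ξ.dim : ℂ) * (c y * (fourierTime w ξ y)ᴴ).trace ∂(haarProb G) := by
  have h := hasSum_inner_lagKernel w (isotypicC ξ c)
  refine (h.unique (hasSum_single ξ fun η hη => ?_)).trans ?_
  · simp only [isotypicC, ContinuousMap.coe_mk, fourierTime_isotypic_of_ne hη, Matrix.zero_mul,
      Matrix.trace_zero, mul_zero, integral_zero]
  · simp only [isotypicC, ContinuousMap.coe_mk, fourierTime_isotypic]

theorem inner_lagKernel_isotypicC_of_ne {ξ η : UnitaryDual G} (h : ξ ≠ η)
    (c : C(G, Matrix (Fin ξ.dim) (Fin ξ.dim) ℂ)) (c' : C(G, Matrix (Fin η.dim) (Fin η.dim) ℂ)) :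
    inner ℂ (lagKernel (isotypicC ξ c)) (lagKernel (isotypicC η c')) = 0 := by
  rw [inner_lagKernel_isotypicC]
  simp only [isotypicC, ContinuousMap.coe_mk, fourierTime_isotypic_of_ne h.symm,
    conjTranspose_zero, Matrix.trace_zero, mul_zero, integral_zero]

theorem inner_lagKernel_isotypicC_self (ξ : UnitaryDual G)
    (c c' : C(G, Matrix (Fin ξ.dim) (Fin ξ.dim) ℂ)) :
    inner ℂ (lagKernel (isotypicC ξ c)) (lagKernel (isotypicC ξ c')) =
      ∫ y, (ξ.dim : ℂ) * (c' y * (c y)ᴴ).trace ∂(haarProb G) := by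
  rw [inner_lagKernel_isotypicC]
  simp only [isotypicC, ContinuousMap.coe_mk, fourierTime_isotypic]

/-- Plancherel in the second variable for each fixed x. The arguments swap because `inner` is linear
in its second slot and `tfInner` in its first. -/
theorem tfInner_fourierLag (w w' : C(G × G, ℂ)) :
    tfInner (fourierLag w) (fourierLag w') = inner ℂ (lagKernel w') (lagKernel w) := by
  rw [inner_lagKernel]
  exact integral_congr_ae (Filter.Eventually.of_forall fun x =>
    (hasSum_plancherel (w.curry x) (w'.curry x)).tsum_eq)

omit [T2Space G] in
theorem isSchwartz_lagProduct (u v : SchwartzBruhat G) :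
    IsSchwartz (lagProduct (u : G → ℂ) (v : G → ℂ)) :=
  lagProduct_mem u v

/-- The shear undoes the lag. Together with the isometry of the partial Fourier transform this is
the unitarity of R on test functions. -/
theorem lagKernel_lagProduct (u v : SchwartzBruhat G) :
    lagKernel ⟨lagProduct (u : G → ℂ) v, (isSchwartz_lagProduct u v).continuous⟩ =
      tensor (schwartzToL2 u) (schwartzToL2 v) := by
  rw [schwartzToL2, schwartzToL2, ← kernel_mulTensor, lagKernel]
  congr 1
  ext p
  simp [shear, lagProduct, mulTensor]

/-- Trigonometric polynomials are test functions and are dense by Peter–Weyl. -/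
theorem denseRange_schwartzToL2 : DenseRange (schwartzToL2 (G := G)) := by
  have h := Submodule.topologicalClosure_eq_top_iff.2 (trigPoly_orthogonal (G := G))
  have h2 : Dense (((trigPoly G).map (toL2 (G := G) : C(G, ℂ) →ₗ[ℂ] Lp ℂ 2 (haarProb G)) :
      Submodule ℂ _) : Set (Lp ℂ 2 (haarProb G))) :=
    Submodule.dense_iff_topologicalClosure_eq_top.2 h
  refine h2.mono ?_
  rintro _ ⟨f, hf, rfl⟩
  exact ⟨⟨f, isSchwartz_of_mem_trigPoly hf⟩, rfl⟩

/-- `HasTrace` quantifies over orthonormal bases, so uniqueness rests on the existence of one. -/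
theorem HasTrace.unique {H : Type u} [NormedAddCommGroup H] [InnerProductSpace ℂ H]
    [CompleteSpace H] {T : H →L[ℂ] H} {a b : ℂ} (ha : HasTrace T a) (hb : HasTrace T b) :
    a = b := by
  obtain ⟨s, e, -⟩ := exists_hilbertBasis ℂ H
  exact (ha s e).unique (hb s e)

/-- Orthogonal vectors with summable squared norms are summable. -/
theorem summable_of_orthogonal {ι K : Type*} [NormedAddCommGroup K] [InnerProductSpace ℂ K]
    [CompleteSpace K] {k : ι → K} (hk : ∀ i j, i ≠ j → inner ℂ (k i) (k j) = 0)
    (hs : Summable fun i => ‖k i‖ ^ 2) : Summable k := by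
  have h : OrthogonalFamily ℂ (fun i => (ℂ ∙ k i : Submodule ℂ K))
      fun i => (ℂ ∙ k i : Submodule ℂ K).subtypeₗᵢ := by
    rintro i j hij ⟨v, hv⟩ ⟨w, hw⟩
    obtain ⟨a, rfl⟩ := Submodule.mem_span_singleton.1 hv
    obtain ⟨b, rfl⟩ := Submodule.mem_span_singleton.1 hw
    simp [inner_smul_left, inner_smul_right, hk i j hij]
  exact (h.summable_iff_norm_sq_summable fun i =>
    ⟨k i, Submodule.mem_span_singleton_self _⟩).2 hs

namespace TFTransform

variable (D : TFTransform G)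

theorem continuous_kernel (ξ : UnitaryDual G) : Continuous (D.kernel ξ) :=
  continuous_matrix fun i j => (D.isSchwartz_kernel ξ i j).continuous

/-- The field `φ_D^* · (𝓕 ⊗ I) w`. -/
def adjointField (w : C(G × G, ℂ)) (ξ : UnitaryDual G) :
    C(G, Matrix (Fin ξ.dim) (Fin ξ.dim) ℂ) :=
  ⟨fun y => (D.kernel ξ y)ᴴ * fourierTime w ξ y,
    (D.continuous_kernel ξ).matrix_conjTranspose.matrix_mul (continuous_fourierTime w ξ)⟩

/-- The isotypic components of the kernel of the quantization of the symbol `(I ⊗ 𝓕) w`. -/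
def symbolKernel (w : C(G × G, ℂ)) (ξ : UnitaryDual G) : KernelSpace (haarProb G) :=
  lagKernel (isotypicC ξ (D.adjointField w ξ))

/-- Plancherel in the first variable expands ⟨D(u, v), a⟩, and cyclicity of the trace moves φ_D to
the symbol as φ_D^*. No bound on the kernel enters: the series is asserted to converge only after
pairing with u ⊗ v^*. -/
theorem hasSum_inner_symbolKernel (w : C(G × G, ℂ)) (u v : SchwartzBruhat G) :
    HasSum (fun ξ => inner ℂ (D.symbolKernel w ξ) (tensor (schwartzToL2 u) (schwartzToL2 v)))
      (tfInner (D.transform u v) (fourierLag w)) := by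
  obtain ⟨W, hW, h1, h2⟩ := D.exists_lag u v
  let W' : C(G × G, ℂ) := ⟨W, hW.continuous⟩
  have h3 := hasSum_inner_lagKernel w W'
  rw [← tfInner_fourierLag] at h3
  rw [h1]
  refine (congrArg (fun f => HasSum f _) (funext fun ξ => ?_)).mpr h3
  rw [← lagKernel_lagProduct, ← inner_conj_symm (𝕜 := ℂ), symbolKernel, inner_lagKernel_isotypicC,
    ← integral_conj]
  refine integral_congr_ae (Filter.Eventually.of_forall fun y => ?_)
  simp only [W', ContinuousMap.coe_mk, h2, adjointField, map_mul, Complex.conj_natCast]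
  rw [starRingEnd_apply, ← Matrix.trace_conjTranspose]
  simp only [conjTranspose_mul, conjTranspose_conjTranspose]
  rw [← Matrix.mul_assoc, Matrix.trace_mul_comm, ← Matrix.mul_assoc]

variable {D} in
theorem inner_symbolKernel_of_ne {ξ η : UnitaryDual G} (h : ξ ≠ η) (w w' : C(G × G, ℂ)) :
    inner ℂ (D.symbolKernel w ξ) (D.symbolKernel w' η) = 0 :=
  inner_lagKernel_isotypicC_of_ne h _ _

theorem inner_symbolKernel (ξ : UnitaryDual G) (w w' : C(G × G, ℂ)) :
    inner ℂ (D.symbolKernel w ξ) (D.symbolKernel w' ξ) = ∫ y, (ξ.dim : ℂ) *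
      ((D.kernel ξ y)ᴴ * fourierTime w' ξ y * ((D.kernel ξ y)ᴴ * fourierTime w ξ y)ᴴ).trace
        ∂(haarProb G) :=
  inner_lagKernel_isotypicC_self ξ _ _

variable {D} in
-- Cyclicity brings φ_D φ_D^* = I together inside each trace, so every term equals the corresponding
-- Plancherel term of the symbols.
theorem hasSum_inner_symbolKernel_self
    (h : ∀ ξ y, D.kernel ξ y ∈ Matrix.unitaryGroup (Fin ξ.dim) ℂ) (w w' : C(G × G, ℂ)) :
    HasSum (fun ξ => inner ℂ (D.symbolKernel w ξ) (D.symbolKernel w' ξ))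
      (inner ℂ (lagKernel w) (lagKernel w')) := by
  refine (congrArg (fun f => HasSum f _) (funext fun ξ => ?_)).mpr (hasSum_inner_lagKernel w w')
  rw [inner_symbolKernel]
  refine integral_congr_ae (Filter.Eventually.of_forall fun y => ?_)
  have h1 := Matrix.mem_unitaryGroup_iff.1 (h ξ y)
  rw [Matrix.star_eq_conjTranspose] at h1
  simp only [conjTranspose_mul, conjTranspose_conjTranspose]
  rw [Matrix.mul_assoc, Matrix.trace_mul_comm, ← Matrix.mul_assoc, Matrix.mul_assoc, h1,
    Matrix.mul_one]

theorem symbolKernel_isotypicC_of_ne {ξ η : UnitaryDual G} (h : η ≠ ξ)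
    (c : C(G, Matrix (Fin ξ.dim) (Fin ξ.dim) ℂ)) : D.symbolKernel (isotypicC ξ c) η = 0 := by
  rw [symbolKernel, lagKernel, ← map_zero (contKernel (haarProb G))]
  congr 1
  ext p
  simp [shear, isotypicC, isotypic, adjointField, fourierTime_isotypic_of_ne h]

/-- The kernel of the quantization of an isotypic symbol. -/
theorem IsQuantization.inner_apply {ξ : UnitaryDual G}
    {c : C(G, Matrix (Fin ξ.dim) (Fin ξ.dim) ℂ)}
    {A : Lp ℂ 2 (haarProb G) →L[ℂ] Lp ℂ 2 (haarProb G)}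
    (hA : D.IsQuantization (fourierLag (isotypicC ξ c)) A) (u v : Lp ℂ 2 (haarProb G)) :
    inner ℂ (A v) u = inner ℂ (D.symbolKernel (isotypicC ξ c) ξ) (tensor u v) := by
  refine denseRange_schwartzToL2.induction_on₂ (isClosed_eq ?_ ?_) (fun u v => ?_) u v
  · exact (A.continuous.comp continuous_snd).inner continuous_fst
  · exact continuous_const.inner
      ((isHilbertTensor_tensor.toCLM.continuous.comp continuous_snd).clm_apply continuous_fst)
  · rw [hA u v]
    -- For an isotypic symbol only the term at ξ is nonzero, so no convergence is needed even though
    -- the kernel is not known to be unitary.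
    refine (D.hasSum_inner_symbolKernel _ u v).unique (hasSum_single ξ fun η hη => ?_)
    rw [D.symbolKernel_isotypicC_of_ne hη, inner_zero_left]

/-- A time-frequency transform with unitary kernel has a unitary quantization. -/
theorem quantizationIsUnitary_of_kernel
    (h : ∀ ξ y, D.kernel ξ y ∈ Matrix.unitaryGroup (Fin ξ.dim) ℂ) : D.QuantizationIsUnitary := by
  -- The components are mutually orthogonal and their squared norms sum to that of `lagKernel w`, so
  -- the series converges in the Hilbert space of kernels.
  have hsum : ∀ w : C(G × G, ℂ), Summable (D.symbolKernel w) := fun w => by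
    refine summable_of_orthogonal (fun ξ η hne => inner_symbolKernel_of_ne hne w w) ?_
    have h1 := (hasSum_inner_symbolKernel_self h w w).summable
    simp only [inner_self_eq_norm_sq_to_K] at h1
    exact_mod_cast h1
  have hq : ∀ w : C(G × G, ℂ), D.IsQuantization (fourierLag w)
      (isHilbertTensor_tensor.op (∑' ξ, D.symbolKernel w ξ)) := by
    intro w u v
    rw [isHilbertTensor_tensor.inner_op]
    have h1 := (hsum w).hasSum.mapL
      (innerSLFlip ℂ (tensor (schwartzToL2 u) (schwartzToL2 v)))
    exact h1.unique (D.hasSum_inner_symbolKernel w u v)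
  rintro _ ⟨w, hw, rfl⟩ _ ⟨w', hw', rfl⟩
  let a : C(G × G, ℂ) := ⟨w, IsSchwartz.continuous hw⟩
  let b : C(G × G, ℂ) := ⟨w', IsSchwartz.continuous hw'⟩
  refine ⟨_, _, hq a, hq b, ?_⟩
  have h1 := isHilbertTensor_tensor.hasTrace
    (fun u v => isHilbertTensor_tensor.inner_op (∑' ξ, D.symbolKernel a ξ) u v)
    (fun u v => isHilbertTensor_tensor.inner_op (∑' ξ, D.symbolKernel b ξ) u v)
  have h2 : inner ℂ (∑' ξ, D.symbolKernel b ξ) (∑' ξ, D.symbolKernel a ξ) =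
      tfInner (fourierLag a) (fourierLag b) := by
    rw [tfInner_fourierLag]
    -- Expanding both series, orthogonality of distinct classes leaves only the diagonal terms.
    have h3 := (hsum a).hasSum.mapL (innerSL ℂ (∑' ξ, D.symbolKernel b ξ))
    refine h3.unique ((congrArg (fun f => HasSum f _) (funext fun ξ => ?_)).mpr
      (hasSum_inner_symbolKernel_self h b a))
    have h4 := (hsum b).hasSum.mapL (innerSLFlip ℂ (D.symbolKernel a ξ))
    exact h4.unique (hasSum_single ξ fun η hη => inner_symbolKernel_of_ne hη b a)
  change HasTrace _ (tfInner (fourierLag a) (fourierLag b))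
  rw [← h2]
  exact h1

/-- A unitary quantization has a unitary kernel. -/
theorem kernel_mem_unitaryGroup_of_quantization (h : D.QuantizationIsUnitary)
    (ξ : UnitaryDual G) (y : G) : D.kernel ξ y ∈ Matrix.unitaryGroup (Fin ξ.dim) ℂ := by
  rw [Matrix.mem_unitaryGroup_iff, Matrix.star_eq_conjTranspose]
  refine Matrix.ext_iff_trace_mul_right.2 fun m => ?_
  have hf : IsSchwartz fun y => ((D.kernel ξ y)ᴴ * m * D.kernel ξ y).trace - m.trace := by
    have h1 : ∀ i j, IsSchwartz fun y => ((D.kernel ξ y)ᴴ * m) i j :=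
      D.isSchwartz_conjTranspose_kernel_mul ξ fun _ _ => IsSchwartz.const _
    have h2 : IsSchwartz fun y => ((D.kernel ξ y)ᴴ * m * D.kernel ξ y).trace := by
      simp only [Matrix.trace, Matrix.diag_apply, Matrix.mul_apply (M := _ * m)]
      exact IsSchwartz.sum _ fun i _ => IsSchwartz.sum _ fun j _ =>
        (h1 i j).mul (D.isSchwartz_kernel ξ j i)
    simpa only [sub_eq_add_neg] using h2.add (IsSchwartz.const (-m.trace))
  let f : C(G, ℂ) := ⟨_, hf.continuous⟩
  have hfa : ∀ y, f y = ((D.kernel ξ y)ᴴ * m * D.kernel ξ y).trace - m.trace := fun _ => rfl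
  -- The weight conj f is chosen to make the difference of the two sides of the trace identity equal
  -- to d_ξ ∫ |f|², which forces f = 0. The second symbol is the identity at ξ.
  let c : C(G, Matrix (Fin ξ.dim) (Fin ξ.dim) ℂ) := ⟨fun y => conj (f y) • m,
    (Complex.continuous_conj.comp f.continuous).smul continuous_const⟩
  let c' : C(G, Matrix (Fin ξ.dim) (Fin ξ.dim) ℂ) := ⟨fun _ => 1, continuous_const⟩
  have hc : IsSchwartz (isotypic ξ c) := isSchwartz_isotypic ξ fun i j =>
    hf.conj.mul (IsSchwartz.const (m i j))
  have hc' : IsSchwartz (isotypic ξ c') := isSchwartz_isotypic ξ fun i j => IsSchwartz.const _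
  obtain ⟨A, B, hA, hB, htr⟩ := h _ ⟨_, hc, rfl⟩ _ ⟨_, hc', rfl⟩
  have h1 := htr.unique (isHilbertTensor_tensor.hasTrace
    (IsQuantization.inner_apply D (c := c) hA) (IsQuantization.inner_apply D (c := c') hB))
  have h2 := tfInner_fourierLag (isotypicC ξ c) (isotypicC ξ c')
  rw [inner_lagKernel_isotypicC_self] at h2
  rw [inner_symbolKernel] at h1
  have h3 := h1.symm.trans h2
  simp only [isotypicC, ContinuousMap.coe_mk, fourierTime_isotypic, c, c', Matrix.mul_one,
    conjTranspose_conjTranspose, conjTranspose_one, Matrix.mul_smul, Matrix.smul_mul,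
    Matrix.trace_smul, smul_eq_mul] at h3
  have hk := D.continuous_kernel ξ
  have hcf : Continuous fun y => conj (f y) := Complex.continuous_conj.comp f.continuous
  rw [integral_const_mul, integral_const_mul] at h3
  have h4 := sub_eq_zero.2 (mul_left_cancel₀ ξ.dim_ne_zero h3)
  rw [← integral_sub (integrable_of_continuous (by fun_prop))
    (integrable_of_continuous (by fun_prop))] at h4
  have h5 : inner ℂ (toL2 f) (toL2 f) = 0 := by
    rw [inner_toL2, ← h4]
    refine integral_congr_ae (Filter.Eventually.of_forall fun y => ?_)
    simp only [hfa]
    ring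
  have h6 : f = 0 := toL2_injective ((inner_self_eq_zero.1 h5).trans (map_zero _).symm)
  have h7 : ((D.kernel ξ y)ᴴ * m * D.kernel ξ y).trace = m.trace :=
    sub_eq_zero.1 (DFunLike.congr_fun h6 y)
  -- Cyclicity turns tr(φ_D^* m φ_D) into tr(φ_D φ_D^* m), matching the goal.
  rw [Matrix.one_mul, ← h7, Matrix.trace_mul_comm, ← Matrix.mul_assoc, Matrix.trace_mul_comm,
    Matrix.mul_assoc]

end TFTransform

end Quantization

end TimeFrequency

end

/-! ### The equivalence of the four conditions -/

theorem mainTheorem1 {G : Type*} [Group G] [TopologicalSpace G] [IsTopologicalGroup G] [T2Space G]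
    [CompactSpace G] [MeasurableSpace G] [BorelSpace G] :
    (∀ D : TimeFrequency.TFTransform G,
      List.TFAE
        [∀ (u : TimeFrequency.SchwartzBruhat G) (y : G),
          D.distribution (TimeFrequency.dirac 1) (TimeFrequency.dirac y)
            (D.transform u TimeFrequency.SchwartzBruhat.one) = (u : G → ℂ) 1,
        D.IsUnitary,
        D.QuantizationIsUnitary,
        ∀ (ξ : TimeFrequency.UnitaryDual G) (y : G),
          D.kernel ξ y ∈ Matrix.unitaryGroup (Fin ξ.dim) ℂ]) ∧
    (∀ u v : TimeFrequency.SchwartzBruhat G,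
      (TimeFrequency.kohnNirenberg G).transform u v =
        TimeFrequency.rihaczek (u : G → ℂ) (v : G → ℂ)) ∧
    (TimeFrequency.kohnNirenberg G).IsUnitary := by
  refine ⟨fun D => ?_, TimeFrequency.kohnNirenberg_transform,
    TimeFrequency.kohnNirenberg_isUnitary⟩
  tfae_have 1 → 4 := fun h => D.kernel_mem_unitaryGroup h
  tfae_have 4 → 2 := fun h => D.isUnitary_of_kernel h
  tfae_have 2 → 1 := fun h => D.distribution_dirac_of_isUnitary h
  tfae_have 4 → 3 := fun h => D.quantizationIsUnitary_of_kernel h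
  tfae_have 3 → 4 := fun h => D.kernel_mem_unitaryGroup_of_quantization h
  tfae_finish
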